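/- **Model.** There are $n\ge 2$ asynchronous processes $p_0,\dots,p_{n-1}$ which communicate by atomic instructions (Read, Write, or Read-Modify-Write) on shared base objects; each such instruction is a *step*. A finite execution is a finite sequence of invocations, steps and responses in which each process runs the code of the operations it invokes, one operation at a time; processes may stop at any point. Process $p_0$ is the owner and invokes $\mathsf{Put}(x)$, $x\in\{1,2,\dots\}$, and $\mathsf{Take}()$; the other processes are thieves and invoke $\mathsf{Steal}()$. Fix $m\ge 1$ and consider only executions in which $\mathsf{Put}$ is invoked at most $m$ times. **MaxRegister of Aspnes, Attiya and Censor.** A register for the $k$ values $0,\dots,k-1$ is trivial if $k\le 1$ (it reads $0$, and writes do nothing). For $k\ge 2$ it consists of a bit $switch$, initially $0$, a register $left$ for $\lceil k/2\rceil$ values and a register $right$ for $\lfloor k/2\rfloor$ values. $\mathsf{MaxRead}$ reads $switch$; if it is $0$ it returns $left.\mathsf{MaxRead}()$, and otherwise $right.\mathsf{MaxRead}()+\lceil k/2\rceil$. $\mathsf{MaxWrite}(v)$ with $v<\lceil k/2\rceil$ reads $switch$ and, if it is $0$, executes $left.\mathsf{MaxWrite}(v)$; with $v\ge\lceil k/2\rceil$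 it executes $right.\mathsf{MaxWrite}(v-\lceil k/2\rceil)$ and then writes $1$ into $switch$. **WS-MULT.** $Head$ is such a register with the $m+1$ values $1,\dots,m+1$ (stored as $0,\dots,m$), initially $1$. $Tasks[1,2,\dots]$ is an array of Read/Write objects with $Tasks[1]=Tasks[2]=\bot$ initially and arbitrary other initial contents, and $tail$, initially $0$, is a persistent local variable of the owner. Instructions in braces may be executed in any order, also with their steps interleaved. - $\mathsf{Put}(x)$: $tail\leftarrow tail+1$; $\{Tasks[tail].\mathsf{Write}(x),\ Tasks[tail+2].\mathsf{Write}(\bot)\}$; return $\mathsf{true}$. - $\mathsf{Take}()$: $head\leftarrow Head.\mathsf{MaxRead}()$; if $head\le tail$ then $\{x\leftarrow Tasks[head].\mathsf{Read}(),\ Head.\mathsf{MaxWrite}(head+1)\}$ and return $x$; otherwise return $\mathsf{empty}$. - $\mathsf{Steal}()$: $head\leftarrow Head.\mathsf{MaxRead}()$; $x\leftarrow Tasks[head].\mathsf{Read}()$; if $x\ne\bot$ then $Head.\mathsf{MaxWrite}(head+1)$ and return $x$; otherwise return $\mathsf{empty}$. **Work-stealing with multiplicity.** This is the set-sequential object whose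 states are finite strings of tasks, initially empty, with these transitions, each performed by one concurrency class: $\mathsf{Put}(x)$ alone, returning $\mathsf{true}$, changes $q$ to $q\cdot x$; at most one $\mathsf{Take}$ together with $t\le n-1$ $\mathsf{Steal}$s (at least one operation in total), all returning $x$, change $x\cdot q$ to $q$; in the empty state, $\mathsf{Take}$ alone or $\mathsf{Steal}$ alone returns $\mathsf{empty}$ and leaves the state empty. A finite execution is *set-linearizable* if there is a set-sequential execution of this object which contains every complete operation and possibly some pending ones, each once, agrees with their inputs and (for complete operations) outputs, and places an operation in an earlier class than another whenever the first responds before the second is invoked. **Theorem.** With $Head$ implemented in this way, WS-MULT is set-linearizable for work-stealing with multiplicity and fully Read/Write: every finite execution with at most $m$ invocations of $\mathsf{Put}$ is set-linearizable, and each of its steps is a Read or a Write. There is a constant $C$, independent of $n$ and $m$, such that in all these executions every $\mathsf{Take}$ and every $\mathsf{Steal}$ executes at most $C\log(m+1)$ steps, every $\mathsf{Put}$ executes at most $C$ steps, and the process of a pending operation can always execute its next step or respond; hence $\mathsf{Take}$ and $\mathsf{Steal}$ are wait-free with step complexity $O(\log m)$. Furthermore, $\mathsf{Steal}$ and $\mathsf{Take}$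 do not use Read-After-Write synchronization patterns. For $\mathsf{Steal}$ this means that no $\mathsf{Steal}$ writes a shared variable and later reads another one. For $\mathsf{Take}$ it means that no $\mathsf{Take}$ does so when the instructions in braces are executed in the order in which they are listed; when they are executed in another order, the only read of $\mathsf{Take}$ that may follow one of its writes to another variable is that of an entry of $Tasks$, which is the read that the braces leave unordered with $\mathsf{MaxWrite}$. -/

import Mathlib

namespace WS

/-! ## Shared memory, programs and executions -/

/-- Atomic instructions on a base object holding values of type `V`: plain reads and writes, and
arbitrary read-modify-write instructions (`Swap`, `Compare&Swap`, ...). -/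
inductive Instr (V : Type) : Type
  | read : Instr V
  | write (v : V) : Instr V
  | rmw (f : V → V) : Instr V

namespace Instr

variable {V : Type}

/-- The type of the answer of an instruction. -/
def Answer : Instr V → Type
  | read => V
  | write _ => Unit
  | rmw _ => V

/-- The contents of the base object after the instruction. -/
def next : Instr V → V → V
  | read, w => w
  | write v, _ => v
  | rmw f, w => f w

/-- The answer of the instruction when the base object contains the given value. -/
def answer : (i : Instr V) → V → i.Answer
  | read, w => w
  | write _, _ => ()
  | rmw _, w => w

/-- The instruction is a plain read or a plain write. -/
def IsReadWrite : Instr V → Prop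
  | read => True
  | write _ => True
  | rmw _ => False

end Instr

/-- Sequential code of one process: a tree of instructions on base objects `l : Loc` with values in
`Val l`, branching on the answers. -/
inductive Prog (Loc : Type) (Val : Loc → Type) (α : Type) : Type
  | ret (a : α) : Prog Loc Val α
  | step (l : Loc) (i : Instr (Val l)) (k : i.Answer → Prog Loc Val α) : Prog Loc Val α

namespace Prog

variable {Loc : Type} {Val : Loc → Type} {α β : Type}

/-- Sequential composition. -/
def bind : Prog Loc Val α → (α → Prog Loc Val β) → Prog Loc Val β
  | ret a, f => f a
  | step l i k, f => step l i fun x => (k x).bind f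

instance : Monad (Prog Loc Val) where
  pure := ret
  bind := bind

/-- Read a base object. -/
def get (l : Loc) : Prog Loc Val (Val l) := step l Instr.read fun x => ret x

/-- Write a base object. -/
def put (l : Loc) (v : Val l) : Prog Loc Val Unit := step l (Instr.write v) fun _ => ret ()

/-- `Interleave P Q R`: the program `R` executes the instructions of `P` and those of `Q`, each in
its own order, and merges the two in some way (which may depend on the answers received). -/
inductive Interleave : Prog Loc Val α → Prog Loc Val β → Prog Loc Val (α × β) → Prop
  | left_done (a : α) (Q : Prog Loc Val β) :
      Interleave (ret a) Q (Q.bind fun b => ret (a, b))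
  | right_done (P : Prog Loc Val α) (b : β) :
      Interleave P (ret b) (P.bind fun a => ret (a, b))
  | left_step (l : Loc) (i : Instr (Val l)) (k : i.Answer → Prog Loc Val α) (Q : Prog Loc Val β)
      (r : i.Answer → Prog Loc Val (α × β)) (h : ∀ x, Interleave (k x) Q (r x)) :
      Interleave (step l i k) Q (step l i r)
  | right_step (l : Loc) (i : Instr (Val l)) (P : Prog Loc Val α) (k : i.Answer → Prog Loc Val β)
      (r : i.Answer → Prog Loc Val (α × β)) (h : ∀ x, Interleave P (k x) (r x)) :
      Interleave P (step l i k) (step l i r)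

end Prog

/-- How a line `{P, Q}` of unordered instructions is executed: in the order in which they are
listed, or in any order. -/
inductive LineOrder : Type
  | asListed
  | anyOrder

/-- The programs that execute the line `{P, Q}`. -/
def LineOrder.line {Loc : Type} {Val : Loc → Type} {α β : Type} :
    LineOrder → Prog Loc Val α → Prog Loc Val β → Set (Prog Loc Val (α × β))
  | asListed, P, Q => {P.bind fun a => Q.bind fun b => Prog.ret (a, b)}
  | anyOrder, P, Q => {R | Prog.Interleave P Q R}

/-- An algorithm for `n` processes. `code op s` is the set of programs that a process with
persistent local variables `s` may run when it invokes `op`; such a program returns the response and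
the new persistent local variables. -/
structure Algorithm (n : ℕ) (Loc : Type) (Val : Loc → Type) (Op Resp : Type) where
  /-- The persistent local variables of a process. -/
  Local : Type
  initLocal : Local
  initMem : (l : Loc) → Val l
  /-- Which process may invoke which operation. -/
  permits : Fin n → Op → Prop
  code : Op → Local → Set (Prog Loc Val (Resp × Local))

/-- The events of an execution: invocations and responses of operations, and steps, that is,
instructions on base objects. -/
inductive Event (n : ℕ) (Loc : Type) (Val : Loc → Type) (Op Resp : Type) : Type
  | inv (p : Fin n) (op : Op)
  | step (p : Fin n) (l : Loc) (i : Instr (Val l))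
  | res (p : Fin n) (r : Resp)

/-- The process of an event. -/
def Event.proc {n : ℕ} {Loc : Type} {Val : Loc → Type} {Op Resp : Type} :
    Event n Loc Val Op Resp → Fin n
  | inv p _ => p
  | step p _ _ => p
  | res p _ => p

namespace Algorithm

variable {n : ℕ} {Loc : Type} {Val : Loc → Type} {Op Resp : Type}

/-- A configuration: the shared memory, the persistent local variables of every process, and what
remains of the program of its pending operation, if there is one. -/
structure Config (A : Algorithm n Loc Val Op Resp) where
  mem : (l : Loc) → Val l
  loc : Fin n → A.Local
  run : Fin n → Option (Prog Loc Val (Resp × A.Local))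

/-- The initial configuration. -/
def init (A : Algorithm n Loc Val Op Resp) : A.Config where
  mem := A.initMem
  loc := fun _ => A.initLocal
  run := fun _ => none

variable [DecidableEq Loc]

/-- The transitions between configurations. -/
inductive Step (A : Algorithm n Loc Val Op Resp) :
    A.Config → Event n Loc Val Op Resp → A.Config → Prop
  | inv (c : A.Config) (p : Fin n) (op : Op) (P : Prog Loc Val (Resp × A.Local))
      (idle : c.run p = none) (perm : A.permits p op) (hP : P ∈ A.code op (c.loc p)) :
      Step A c (.inv p op) { c with run := Function.update c.run p (some P) }
  | step (c : A.Config) (p : Fin n) (l : Loc) (i : Instr (Val l))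
      (k : i.Answer → Prog Loc Val (Resp × A.Local)) (h : c.run p = some (.step l i k)) :
      Step A c (.step p l i)
        { c with
          mem := Function.update c.mem l (i.next (c.mem l))
          run := Function.update c.run p (some (k (i.answer (c.mem l)))) }
  | res (c : A.Config) (p : Fin n) (r : Resp) (s : A.Local) (h : c.run p = some (.ret (r, s))) :
      Step A c (.res p r)
        { c with
          loc := Function.update c.loc p s
          run := Function.update c.run p none }

/-- `A.Exec E c`: the list of events `E` is a finite execution of `A`, and it ends in the
configuration `c`. -/
inductive Exec (A : Algorithm n Loc Val Op Resp) :
    List (Event n Loc Val Op Resp) → A.Config → Prop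
  | nil : Exec A [] A.init
  | snoc (E : List (Event n Loc Val Op Resp)) (c : A.Config) (e : Event n Loc Val Op Resp)
      (c' : A.Config) (hE : Exec A E c) (he : A.Step c e c') : Exec A (E ++ [e]) c'

end Algorithm

/-! ## Operations of an execution

An operation of an execution `E` is identified with the position of its invocation in `E`. -/

section Operations

variable {n : ℕ} {Loc : Type} {Val : Loc → Type} {Op Resp : Type}

/-- The operation invoked by `p` at position `i` returns `r` at position `j`: this is the first
response of `p` after `i`. -/
def Returns (E : List (Event n Loc Val Op Resp)) (i j : ℕ) (p : Fin n) (r : Resp) : Prop :=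
  (∃ op, E[i]? = some (.inv p op)) ∧ i < j ∧ E[j]? = some (.res p r) ∧
    ∀ k, i < k → k < j → ∀ r', E[k]? ≠ some (.res p r')

/-- The operation at `i` is complete. -/
def Complete (E : List (Event n Loc Val Op Resp)) (i : ℕ) : Prop :=
  ∃ j p r, Returns E i j p r

/-- The operation at `i` responds before the invocation of the operation at `i'`. -/
def Precedes (E : List (Event n Loc Val Op Resp)) (i i' : ℕ) : Prop :=
  ∃ j p r, Returns E i j p r ∧ j < i'

/-- The event at position `k` is the instruction `a` on the base object `l`, executed by the
operation at `i`. -/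
def StepOf (E : List (Event n Loc Val Op Resp)) (i k : ℕ) (l : Loc) (a : Instr (Val l)) : Prop :=
  ∃ p op, E[i]? = some (.inv p op) ∧ i < k ∧ E[k]? = some (.step p l a) ∧
    ∀ k', i < k' → k' < k → ∀ r, E[k']? ≠ some (.res p r)

/-- The number of steps that the operation at `i` executes in `E`. -/
noncomputable def stepCount (E : List (Event n Loc Val Op Resp)) (i : ℕ) : ℕ :=
  Set.ncard {k | ∃ l a, StepOf E i k l a}

/-- A read-after-write pattern in the operation at `i`: it writes the base object `l` and later
reads another base object `l'`. -/
def ReadAfterWrite (E : List (Event n Loc Val Op Resp)) (i : ℕ) (l l' : Loc) : Prop :=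
  l ≠ l' ∧ ∃ k k' v, k < k' ∧ StepOf E i k l (.write v) ∧ StepOf E i k' l' .read

/-- Every step of the execution is a plain read or a plain write. -/
def FullyReadWrite (E : List (Event n Loc Val Op Resp)) : Prop :=
  ∀ p l a, Event.step p l a ∈ E → a.IsReadWrite

/-- In the executions of `A` that satisfy `K`, the operations that satisfy `Q` need at most `B`
steps: they never execute more, and while one of them is pending, its process has a next event (an
instruction or the response) that it can execute immediately. -/
def Algorithm.StepComplexityLE [DecidableEq Loc] (A : Algorithm n Loc Val Op Resp)
    (K : List (Event n Loc Val Op Resp) → Prop) (Q : Op → Prop) (B : ℝ) : Prop :=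
  ∀ E c, A.Exec E c → K E → ∀ i p op, E[i]? = some (.inv p op) → Q op →
    (stepCount E i : ℝ) ≤ B ∧
      (¬ Complete E i → ∃ e c', e.proc = p ∧ A.Step c e c')

end Operations

/-! ## Set-linearizability -/

/-- A set-sequential specification: `δ q C q'` says that from state `q` the concurrency class `C`,
a collection of invocations with their responses, may lead to state `q'`. -/
structure SetSpec (Op Resp : Type) where
  State : Type
  init : State
  δ : State → Multiset (Op × Resp) → State → Prop

/-- `T.Runs q S`: the sequence `S` of concurrency classes is produced by `T` from state `q`. -/
def SetSpec.Runs {Op Resp : Type} (T : SetSpec Op Resp) :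
    T.State → List (Multiset (Op × Resp)) → Prop
  | _, [] => True
  | q, C :: S => ∃ q', T.δ q C q' ∧ T.Runs q' S

/-- The execution `E` is set-linearizable for `T`: there is a sequence `S` of pairwise disjoint
classes of operations of `E`, with inputs `op` and outputs `out`, that contains all complete
operations and possibly some pending ones, agrees with the inputs and outputs in `E`, respects the
order of non-overlapping operations, and is a set-sequential execution of `T`. -/
def SetLinearizable {n : ℕ} {Loc : Type} {Val : Loc → Type} {Op Resp : Type}
    (T : SetSpec Op Resp) (E : List (Event n Loc Val Op Resp)) : Prop :=
  ∃ (S : List (Finset ℕ)) (op : ℕ → Op) (out : ℕ → Resp),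
    (∀ C ∈ S, ∀ i ∈ C, ∃ p, E[i]? = some (.inv p (op i))) ∧
    S.Pairwise Disjoint ∧
    (∀ i j p r, Returns E i j p r → (∃ C ∈ S, i ∈ C) ∧ out i = r) ∧
    (∀ (a b : ℕ) (C D : Finset ℕ), S[a]? = some C → S[b]? = some D →
      ∀ i ∈ C, ∀ j ∈ D, Precedes E i j → a < b) ∧
    T.Runs T.init (S.map fun C => C.val.map fun i => (op i, out i))

/-! ## Work-stealing with multiplicity -/

/-- The operations. -/
inductive Op : Type
  | put (x : ℕ+)
  | take
  | steal

/-- The responses; `val none` stands for a returned `⊥`, which no specification allows. -/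
inductive Resp : Type
  | ok
  | empty
  | val (x : Option ℕ+)

/-- The transitions of (FIFO) work-stealing with multiplicity for `n` processes. -/
inductive MultStep (n : ℕ) : List ℕ+ → Multiset (Op × Resp) → List ℕ+ → Prop
  | put (q : List ℕ+) (x : ℕ+) : MultStep n q {(Op.put x, Resp.ok)} (q ++ [x])
  | take (q : List ℕ+) (x : ℕ+) (t : ℕ) (ht : t ≤ n - 1) :
      MultStep n (x :: q)
        ((Op.take, Resp.val (some x)) ::ₘ Multiset.replicate t (Op.steal, Resp.val (some x))) q
  | steal (q : List ℕ+) (x : ℕ+) (t : ℕ) (h1 : 1 ≤ t) (ht : t ≤ n - 1) :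
      MultStep n (x :: q) (Multiset.replicate t (Op.steal, Resp.val (some x))) q
  | takeEmpty : MultStep n [] {(Op.take, Resp.empty)} []
  | stealEmpty : MultStep n [] {(Op.steal, Resp.empty)} []

/-- The specification of (FIFO) work-stealing with multiplicity for `n` processes. -/
def multSpec (n : ℕ) : SetSpec Op Resp where
  State := List ℕ+
  init := []
  δ := MultStep n

/-! ## The algorithm -/

/-- The base objects: the entries of the array `Tasks`, and the switch bits at the nodes of the
binary tree of the max register; a node is given by the path that leads to it from the root
(`false` = left, `true` = right). -/
inductive Loc : Type
  | task (i : ℕ)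
  | switch (node : List Bool)
  deriving DecidableEq

/-- The values of the base objects; `none` in an entry of `Tasks` is `⊥`. -/
def Val : Loc → Type
  | .task _ => Option ℕ+
  | .switch _ => Bool

/-- The code of the processes over these base objects. -/
abbrev Code (α : Type) : Type := Prog Loc Val α

/-- `Tasks[i].Read()`. -/
def readTask (i : ℕ) : Code (Option ℕ+) := Prog.get (Val := Val) (.task i)

/-- `Tasks[i].Write(x)`. -/
def writeTask (i : ℕ) (x : Option ℕ+) : Code Unit := Prog.put (Val := Val) (.task i) x

/-- Read the switch of a node. -/
def readSwitch (v : List Bool) : Code Bool := Prog.get (Val := Val) (.switch v)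

/-- Set the switch of a node to 1. -/
def setSwitch (v : List Bool) : Code Unit := Prog.put (Val := Val) (.switch v) true

/-- The read operation of the Aspnes-Attiya-Censor max register with values `0, ..., k - 1`, whose
root is the node `v`: its left subtree is a max register with `⌈k/2⌉` values, its right subtree one
with `⌊k/2⌋` values, and the switch of `v` tells which one to use. -/
def maxRead (k : ℕ) (v : List Bool) : Code ℕ :=
  if _h : k ≤ 1 then
    pure 0
  else do
    let s ← readSwitch v
    if s then do
      let x ← maxRead (k / 2) (v ++ [true])
      pure (x + (k + 1) / 2)
    else
      maxRead ((k + 1) / 2) (v ++ [false])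
  termination_by k
  decreasing_by all_goals omega

/-- The write operation of the Aspnes-Attiya-Censor max register with values `0, ..., k - 1`, whose
root is the node `v`: a value of the lower half is written into the left subtree unless the switch
is already set; a value of the upper half is written into the right subtree, and then the switch is
set. -/
def maxWrite (k : ℕ) (v : List Bool) (x : ℕ) : Code Unit :=
  if _h : k ≤ 1 then
    pure ()
  else if x < (k + 1) / 2 then do
    let s ← readSwitch v
    if s then
      pure ()
    else
      maxWrite ((k + 1) / 2) (v ++ [false]) x
  else do
    maxWrite (k / 2) (v ++ [true]) (x - (k + 1) / 2)
    setSwitch v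
  termination_by k
  decreasing_by all_goals omega

/-- `Head.MaxRead()`; the register `Head` has the values `1, ..., m + 1`, stored as
`0, ..., m`. -/
def headRead (m : ℕ) : Code ℕ := do
  let x ← maxRead (m + 1) []
  pure (x + 1)

/-- `Head.MaxWrite(h)`. -/
def headWrite (m h : ℕ) : Code Unit := maxWrite (m + 1) [] (h - 1)

/-- The code of `Put(x)`; `tail` is the value of the owner's persistent variable. -/
def putCode (o : LineOrder) (x : ℕ+) (tail : ℕ) : Set (Code (Resp × ℕ)) :=
  {P | ∃ line ∈ o.line (writeTask (tail + 1) (some x)) (writeTask (tail + 1 + 2) none),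
    P = do
      let _ ← line
      pure (Resp.ok, tail + 1)}

/-- The code of `Take()`. -/
def takeCode (m : ℕ) (o : LineOrder) (tail : ℕ) : Set (Code (Resp × ℕ)) :=
  {P | ∃ line : ℕ → Code (Option ℕ+ × Unit),
    (∀ head, line head ∈ o.line (readTask head) (headWrite m (head + 1))) ∧
    P = do
      let head ← headRead m
      if head ≤ tail then do
        let y ← line head
        pure (Resp.val y.1, tail)
      else
        pure (Resp.empty, tail)}

/-- The code of `Steal()`; a thief has no persistent variables, so the second component is passed
on unchanged. -/
def stealCode (m : ℕ) (s : ℕ) : Code (Resp × ℕ) := do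
  let head ← headRead m
  let x ← readTask head
  match x with
  | none => pure (Resp.empty, s)
  | some y => do
    headWrite m (head + 1)
    pure (Resp.val (some y), s)

/-- WS-MULT for `n` processes, with `Head` an Aspnes-Attiya-Censor max register with the values
`1, ..., m + 1`, initially `1`. Process 0 is the owner, the others are thieves; `tasks` is the
initial contents of the array `Tasks`. -/
def wsMult (n m : ℕ) (o : LineOrder) (tasks : ℕ → Option ℕ+) : Algorithm n Loc Val Op Resp where
  Local := ℕ
  initLocal := 0
  initMem
    | .task i => tasks i
    | .switch _ => false
  permits
    | p, .put _ => p.val = 0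
    | p, .take => p.val = 0
    | p, .steal => p.val ≠ 0
  code
    | .put x, tail => putCode o x tail
    | .take, tail => takeCode m o tail
    | .steal, s => {stealCode m s}

/-- At most `m` tasks are inserted in `E`: at most `m` of its events invoke `Put`. -/
def AtMostPuts (m : ℕ) {n : ℕ} (E : List (Event n Loc Val Op Resp)) : Prop :=
  Set.ncard {i : ℕ | ∃ p x, E[i]? = some (.inv p (Op.put x))} ≤ m

end WS

namespace WS

/-! ### Arbitrary algorithms: pending operations, step bounds and read-after-write patterns. -/

section Generic

variable {n : ℕ} {Loc : Type} {Val : Loc → Type} {Op Resp : Type} {α β : Type}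

/-! `Head = h` is stored as `h - 1`, so the stored value is the number of tasks removed so far. The
central point is that in WS-MULT the removal of a task is a single write of one bit. Every node with
at least two values has a threshold, the least value of its right subtree, and distinct nodes have
distinct thresholds (`threshold_inj`). A process stores `k + 1` only when the register is already at
least `k`, and on the way it sets only switches with thresholds up to `k + 1`. Hence the set
switches are always exactly those with thresholds up to the current value `removed`
(`MemoryOK.setSwitch`). A write that changes the value sets the switch with threshold `removed + 1`,
so it removes exactly one task, the one that its own operation is going to return
(`Claimed.dequeueStepOK`).

A `MaxRead` that returns `k` shows that the value is now at least `k` and was at most `k` at the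
invocation: a set switch bounds the present value from below, and an unset one bounds it from above,
hence also the earlier values. An operation returning task number `k` (counted from 0) responds only
when the value is at least `k + 1`. So the event that removes this task lies in the interval of
every operation that returns it, and all of these are linearized there as one class. `Put` is
linearized at its write of the task, an empty `Take` at its response, and an empty `Steal` at a read
of its own during which all inserted tasks are removed. The abstract queue is then `inserted`
without its first `removed` entries (`TraceOK.stateAt_succ`).

Two points need care. A pending operation that has already inserted or removed a task must be
linearized as well, or its transition would be missing. And equal tasks may be inserted several
times, so a response does not determine the number of the task; `RemovesOnly` ties an operation that
removes a task to that very removal (`LinPoint.eq_of_remover`).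

Emptiness is seen correctly by thieves because the entry after the last inserted task is always `⊥`.
`Put` overwrites this entry, which is safe since the next one is `⊥` as well outside `Put`; the
write of `⊥` at `tail + 2` restores this reserve, in either order of the two writes. No operation
reads farther, since the register never exceeds the number of inserted tasks.

The argument separates into statements on program trees, which give step bounds and read-after-write
freedom (`Algorithm.static_of_exec`); an invariant of executions that yields local properties of
each event (`invariant_of_exec`); and a linearization built from these properties alone, without
reference to code (`TraceOK.setLinearizable`). -/

theorem getElem?_snoc_eq_some {γ : Type*} {E : List γ} {e a : γ} {i : ℕ} :
    (E ++ [e])[i]? = some a ↔ E[i]? = some a ∨ (i = E.length ∧ e = a) := by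
  rw [List.getElem?_append]
  split_ifs with h
  · constructor
    · exact Or.inl
    · rintro (h' | ⟨h', -⟩)
      · exact h'
      · omega
  · rw [List.getElem?_singleton, List.getElem?_eq_none (by omega)]
    split_ifs with h'
    · have : i = E.length := by omega
      simp [this]
    · have : i ≠ E.length := by omega
      simp [this]

theorem lt_length_of_getElem? {γ : Type*} {E : List γ} {a : γ} {i : ℕ} (h : E[i]? = some a) :
    i < E.length := (List.getElem?_eq_some_iff.1 h).1

/-! ### Pending operations -/

/-- The operation `op` that `p` invoked at `i` has not responded. -/
def Pending (E : List (Event n Loc Val Op Resp)) (i : ℕ) (p : Fin n) (op : Op) : Prop :=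
  E[i]? = some (.inv p op) ∧ ∀ j, i < j → ∀ r, E[j]? ≠ some (.res p r)

theorem pending_snoc {E : List (Event n Loc Val Op Resp)} {e : Event n Loc Val Op Resp} {i : ℕ}
    {p : Fin n} {op : Op} :
    Pending (E ++ [e]) i p op ↔
      (Pending E i p op ∧ ∀ r, e ≠ .res p r) ∨ (i = E.length ∧ e = .inv p op) := by
  simp only [Pending, ne_eq, getElem?_snoc_eq_some]
  constructor
  · rintro ⟨h | h, h'⟩
    · refine Or.inl ⟨⟨h, fun j hj r hr => h' j hj r (Or.inl hr)⟩, fun r hr => ?_⟩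
      exact h' E.length (lt_length_of_getElem? h) r (Or.inr ⟨rfl, hr⟩)
    · exact Or.inr h
  · rintro (⟨⟨h, h'⟩, he⟩ | ⟨rfl, rfl⟩)
    · refine ⟨Or.inl h, fun j hj r => ?_⟩
      rintro (h1 | ⟨-, h1⟩)
      · exact h' j hj r h1
      · exact he r h1
    · refine ⟨Or.inr ⟨rfl, rfl⟩, fun j hj r => ?_⟩
      rintro (h1 | ⟨h1, -⟩)
      · have := lt_length_of_getElem? h1
        omega
      · omega

theorem pending_of_not_complete {E : List (Event n Loc Val Op Resp)} {i : ℕ} {p : Fin n} {op : Op}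
    (hi : E[i]? = some (.inv p op)) (h : ¬ Complete E i) : Pending E i p op := by
  classical
  refine ⟨hi, fun j hj r hr => h ?_⟩
  have hex : ∃ j, i < j ∧ ∃ r, E[j]? = some (.res p r) := ⟨j, hj, r, hr⟩
  obtain ⟨h1, r', h2⟩ := Nat.find_spec hex
  exact ⟨Nat.find hex, p, r', ⟨op, hi⟩, h1, h2,
    fun k hk hk' r'' hr'' => Nat.find_min hex hk' ⟨hk, r'', hr''⟩⟩

theorem stepOf_snoc {E : List (Event n Loc Val Op Resp)} {e : Event n Loc Val Op Resp} {i k : ℕ}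
    {l : Loc} {a : Instr (Val l)} :
    StepOf (E ++ [e]) i k l a ↔
      StepOf E i k l a ∨ (k = E.length ∧ ∃ p op, Pending E i p op ∧ e = .step p l a) := by
  simp only [StepOf, Pending, ne_eq, getElem?_snoc_eq_some]
  constructor
  · rintro ⟨p, op, hi, hik, hk, h⟩
    rcases hk with hk | ⟨rfl, rfl⟩
    · have := lt_length_of_getElem? hk
      rcases hi with hi | ⟨rfl, rfl⟩
      · exact Or.inl ⟨p, op, hi, hik, hk, fun k' h1 h2 r hr => h k' h1 h2 r (Or.inl hr)⟩
      · omega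
    · rcases hi with hi | ⟨rfl, h'⟩
      · exact Or.inr ⟨rfl, p, op, ⟨hi, fun j hj r hr =>
          h j hj (lt_length_of_getElem? hr) r (Or.inl hr)⟩, rfl⟩
      · cases h'
  · rintro (⟨p, op, hi, hik, hk, h⟩ | ⟨rfl, p, op, ⟨hi, h⟩, rfl⟩)
    · refine ⟨p, op, Or.inl hi, hik, Or.inl hk, fun k' h1 h2 r => ?_⟩
      have := lt_length_of_getElem? hk
      rintro (h3 | ⟨rfl, -⟩)
      · exact h k' h1 h2 r h3
      · omega
    · refine ⟨p, op, Or.inl hi, lt_length_of_getElem? hi, Or.inr ⟨rfl, rfl⟩, fun k' h1 h2 r => ?_⟩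
      rintro (h3 | ⟨rfl, -⟩)
      · exact h k' h1 r h3
      · omega

theorem StepOf.lt_length {E : List (Event n Loc Val Op Resp)} {i k : ℕ} {l : Loc}
    {a : Instr (Val l)} (h : StepOf E i k l a) : k < E.length := by
  obtain ⟨p, op, -, -, hk, -⟩ := h
  exact lt_length_of_getElem? hk

theorem StepOf.inv_lt {E : List (Event n Loc Val Op Resp)} {i k : ℕ} {l : Loc}
    {a : Instr (Val l)} (h : StepOf E i k l a) : i < k := by
  obtain ⟨p, op, -, hk, -, -⟩ := h
  exact hk

theorem finite_steps (E : List (Event n Loc Val Op Resp)) (i : ℕ) :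
    {k | ∃ l a, StepOf E i k l a}.Finite :=
  (Set.finite_lt_nat E.length).subset fun _ ⟨_, _, h⟩ => h.lt_length

theorem stepCount_snoc_of_step {E : List (Event n Loc Val Op Resp)} {i : ℕ} {p : Fin n} {op : Op}
    (h : Pending E i p op) (l : Loc) (a : Instr (Val l)) :
    stepCount (E ++ [.step p l a]) i = stepCount E i + 1 := by
  have : {k | ∃ l' a', StepOf (E ++ [.step p l a]) i k l' a'} =
      insert E.length {k | ∃ l a, StepOf E i k l a} := by
    ext k
    simp only [stepOf_snoc, Set.mem_ofPred_eq, Set.mem_insert_iff]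
    constructor
    · rintro ⟨l', a', h' | ⟨rfl, -⟩⟩
      · exact Or.inr ⟨l', a', h'⟩
      · exact Or.inl rfl
    · rintro (rfl | ⟨l', a', h'⟩)
      · exact ⟨l, a, Or.inr ⟨rfl, p, op, h, rfl⟩⟩
      · exact ⟨l', a', Or.inl h'⟩
  rw [stepCount, this, Set.ncard_insert_of_notMem _ (finite_steps E i), stepCount]
  rintro ⟨l', a', h'⟩
  exact lt_irrefl _ h'.lt_length

theorem pending_unique_inv {E : List (Event n Loc Val Op Resp)} {i : ℕ} {p p' : Fin n}
    {op op' : Op} (h : E[i]? = some (.inv p op)) (h' : Pending E i p' op') : p' = p ∧ op' = op := by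
  have := h.symm.trans h'.1
  simp only [Option.some.injEq, Event.inv.injEq] at this
  exact ⟨this.1.symm, this.2.symm⟩

theorem stepOf_snoc_of_ne {E : List (Event n Loc Val Op Resp)} {e : Event n Loc Val Op Resp}
    {i : ℕ} {p : Fin n} {op : Op} (hi : E[i]? = some (.inv p op))
    (he : Pending E i p op → ∀ l a, e ≠ .step p l a) {k : ℕ} {l : Loc} {a : Instr (Val l)} :
    StepOf (E ++ [e]) i k l a ↔ StepOf E i k l a := by
  rw [stepOf_snoc]
  refine ⟨?_, Or.inl⟩
  rintro (h | ⟨-, p', op', h, h'⟩)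
  · exact h
  · obtain ⟨rfl, rfl⟩ := pending_unique_inv hi h
    exact absurd h' (he h l a)

/-! ### Depth and read-after-write patterns of programs -/

namespace Prog

/-- Every execution of the program has at most the given number of steps. -/
def Depth : Prog Loc Val α → ℕ → Prop
  | ret _, _ => True
  | step _ _ _, 0 => False
  | step _ _ k, N + 1 => ∀ x, (k x).Depth N

/-- If the objects in `S` have been written before, then the program reads an object after writing
another one only if it satisfies `ok`. -/
def RawFree (ok : Loc → Prop) : Prog Loc Val α → Set Loc → Prop
  | ret _, _ => True
  | step l i k, S => (i = .read → ∀ l' ∈ S, l' ≠ l → ok l) ∧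
      ∀ x, (k x).RawFree ok (S ∪ {l' | l' = l ∧ ∃ v, i = .write v})

theorem depth_ret (a : α) (N : ℕ) : (ret a : Prog Loc Val α).Depth N := trivial

theorem Depth.mono {P : Prog Loc Val α} {a b : ℕ} (h : P.Depth a) (hab : a ≤ b) : P.Depth b := by
  induction P generalizing a b with
  | ret => trivial
  | step l i k ih =>
    cases a with
    | zero => exact h.elim
    | succ a =>
      cases b with
      | zero => omega
      | succ b => exact fun x => ih x (h x) (by omega)

theorem Depth.bind {P : Prog Loc Val α} {f : α → Prog Loc Val β} {a b : ℕ} (h : P.Depth a)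
    (hf : ∀ x, (f x).Depth b) : (P.bind f).Depth (a + b) := by
  induction P generalizing a with
  | ret x => exact (hf x).mono (by omega)
  | step l i k ih =>
    cases a with
    | zero => exact h.elim
    | succ a =>
      rw [Nat.add_right_comm]
      exact fun x => ih x (h x)

theorem Interleave.depth {P : Prog Loc Val α} {Q : Prog Loc Val β} {R : Prog Loc Val (α × β)}
    (h : Interleave P Q R) {a b : ℕ} (hP : P.Depth a) (hQ : Q.Depth b) : R.Depth (a + b) := by
  induction h generalizing a b with
  | left_done x Q => exact (hQ.bind fun _ => depth_ret _ 0).mono (by omega)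
  | right_done P x => exact (hP.bind fun _ => depth_ret _ 0).mono (by omega)
  | left_step l i k Q r h ih =>
    cases a with
    | zero => exact hP.elim
    | succ a =>
      rw [Nat.add_right_comm]
      exact fun x => ih x (hP x) hQ
  | right_step l i P k r h ih =>
    cases b with
    | zero => exact hQ.elim
    | succ b => exact fun x => ih x hP (hQ x)

theorem interleave_bind (P : Prog Loc Val α) (Q : Prog Loc Val β) :
    Interleave P Q (P.bind fun a => Q.bind fun b => ret (a, b)) := by
  induction P with
  | ret a => exact .left_done a Q
  | step l i k ih => exact .left_step l i k Q _ ih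

theorem bind_ret (P : Prog Loc Val α) : P.bind ret = P := by
  induction P with
  | ret a => rfl
  | step l i k ih => exact congrArg (step l i) (funext ih)

theorem bind_assoc {γ : Type} (P : Prog Loc Val α) (f : α → Prog Loc Val β)
    (g : β → Prog Loc Val γ) : (P.bind f).bind g = P.bind fun x => (f x).bind g := by
  induction P with
  | ret a => rfl
  | step l i k ih => exact congrArg (step l i) (funext ih)

end Prog

/-- The listed order is one of the interleavings, so both readings of the braces can be treated
together wherever the order is irrelevant. -/
theorem LineOrder.interleave {o : LineOrder} {P : Prog Loc Val α} {Q : Prog Loc Val β}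
    {R : Prog Loc Val (α × β)} (h : R ∈ o.line P Q) : Prog.Interleave P Q R := by
  cases o with
  | asListed =>
    obtain rfl : R = _ := h
    exact Prog.interleave_bind P Q
  | anyOrder => exact h

/-- Induction along the execution, carrying the rest of the program of the operation: its depth is
what remains of `N`, and it is `RawFree` relative to the objects that the operation has written so
far. -/
theorem Algorithm.static_of_exec [DecidableEq Loc] {A : Algorithm n Loc Val Op Resp} (ok : Loc → Prop)
    (N : ℕ) {E : List (Event n Loc Val Op Resp)} {c : A.Config} (hE : A.Exec E c) {i : ℕ}
    {p : Fin n} {op : Op} (hi : E[i]? = some (.inv p op))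
    (hop : ∀ s, ∀ P ∈ A.code op s, P.Depth N ∧ P.RawFree ok ∅) :
    stepCount E i ≤ N ∧ (∀ l l', ReadAfterWrite E i l l' → ok l') ∧
      (Pending E i p op → ∃ Q, c.run p = some Q ∧ Q.Depth (N - stepCount E i) ∧
        Q.RawFree ok {l | ∃ k v, StepOf E i k l (.write v)}) := by
  induction hE with
  | nil => simp at hi
  | snoc E c e c' hE he ih =>
    have key : ∀ (hE : E[i]? = some (.inv p op)), (Pending E i p op → ∀ l a, e ≠ .step p l a) →
        stepCount (E ++ [e]) i = stepCount E i ∧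
        (∀ l l', ReadAfterWrite (E ++ [e]) i l l' ↔ ReadAfterWrite E i l l') ∧
        {l | ∃ k v, StepOf (E ++ [e]) i k l (.write v)} = {l | ∃ k v, StepOf E i k l (.write v)} := by
      intro hE he
      simp only [stepCount, ReadAfterWrite, stepOf_snoc_of_ne hE he, true_and, implies_true]
    rcases getElem?_snoc_eq_some.1 hi with hi' | ⟨rfl, rfl⟩
    · obtain ⟨h1, h2, h3⟩ := ih hi'
      by_cases hp : Pending E i p op
      · obtain ⟨Q, hQ, hd, hr⟩ := h3 hp
        cases he with
        | inv q op' P idle perm hP =>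
          obtain ⟨k1, k2, k3⟩ := key hi' (by simp)
          rw [k1, k3]
          refine ⟨h1, fun l l' h => h2 l l' ((k2 l l').1 h), fun _ => ⟨Q, ?_, hd, hr⟩⟩
          have : p ≠ q := by rintro rfl; simp [hQ] at idle
          simp [Function.update_of_ne this, hQ]
        | res q r s h =>
          obtain ⟨k1, k2, k3⟩ := key hi' (by simp)
          rw [k1, k3]
          refine ⟨h1, fun l l' h => h2 l l' ((k2 l l').1 h), fun hp' => ⟨Q, ?_, hd, hr⟩⟩
          have : p ≠ q := by
            rintro rfl
            rcases pending_snoc.1 hp' with ⟨-, h'⟩ | ⟨-, h'⟩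
            · exact h' r rfl
            · cases h'
          simp [Function.update_of_ne this, hQ]
        | step q l a k h =>
          by_cases hpq : p = q
          · subst hpq
            obtain rfl : Q = .step l a k := Option.some.inj (hQ.symm.trans h)
            rw [stepCount_snoc_of_step hp]
            -- A program with a next step has no depth 0, so the budget is not yet used up.
            obtain ⟨M, hM⟩ : ∃ M, N - stepCount E i = M + 1 := by
              cases hM : N - stepCount E i with
              | zero => rw [hM] at hd; exact hd.elim
              | succ M => exact ⟨M, rfl⟩
            rw [hM] at hd
            have hw : {l' | ∃ k v, StepOf (E ++ [.step p l a]) i k l' (.write v)} =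
                {l | ∃ k v, StepOf E i k l (.write v)} ∪ {l' | l' = l ∧ ∃ v, a = .write v} := by
              ext l'
              simp only [stepOf_snoc, Set.mem_union, Set.mem_ofPred_eq]
              constructor
              · rintro ⟨k, v, h' | ⟨rfl, p', op', h', he⟩⟩
                · exact Or.inl ⟨k, v, h'⟩
                · cases he
                  exact Or.inr ⟨rfl, v, rfl⟩
              · rintro (⟨k, v, h'⟩ | ⟨rfl, v, rfl⟩)
                · exact ⟨k, v, Or.inl h'⟩
                · exact ⟨_, v, Or.inr ⟨rfl, p, op, hp, rfl⟩⟩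
            refine ⟨by omega, ?_, fun _ => ⟨_, Function.update_self _ _ _, ?_, ?_⟩⟩
            · rintro l1 l2 ⟨hne, k1, k2, v, hk, hs1, hs2⟩
              rcases stepOf_snoc.1 hs2 with hs2 | ⟨rfl, p', op', h', he⟩
              · rcases stepOf_snoc.1 hs1 with hs1 | ⟨rfl, -⟩
                · exact h2 l1 l2 ⟨hne, k1, k2, v, hk, hs1, hs2⟩
                · have := hs2.lt_length
                  omega
              · rcases stepOf_snoc.1 hs1 with hs | ⟨rfl, -⟩
                · cases he
                  exact hr.1 rfl l1 ⟨k1, v, hs⟩ hne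
                · omega
            · rw [show N - (stepCount E i + 1) = M by omega]
              exact hd _
            · rw [hw]
              exact hr.2 _
          · obtain ⟨k1, k2, k3⟩ := key hi' fun _ l a he => by
              cases he
              exact hpq rfl
            rw [k1, k3]
            refine ⟨h1, fun l l' h => h2 l l' ((k2 l l').1 h), fun hp' => ⟨Q, ?_, hd, hr⟩⟩
            simp [Function.update_of_ne hpq, hQ]
      · obtain ⟨k1, k2, k3⟩ := key hi' fun h => absurd h hp
        rw [k1, k3]
        refine ⟨h1, fun l l' h => h2 l l' ((k2 l l').1 h), fun hp' => ?_⟩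
        rcases pending_snoc.1 hp' with ⟨h', -⟩ | ⟨h', -⟩
        · exact absurd h' hp
        · have := lt_length_of_getElem? hi'
          omega
    · have hno : ∀ k l a, ¬ StepOf (E ++ [.inv p op]) E.length k l a := by
        intro k l a h
        have h1 := h.lt_length
        have h2 := h.inv_lt
        simp at h1
        omega
      have h0 : stepCount (E ++ [.inv p op]) E.length = 0 := by simp [stepCount, hno]
      rw [h0]
      refine ⟨Nat.zero_le _, ?_, fun _ => ?_⟩
      · rintro l l' ⟨-, k, k', v, -, h, -⟩
        exact absurd h (hno _ _ _)
      · cases he with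
        | inv _ _ P idle perm hP =>
          refine ⟨P, Function.update_self _ _ _, (hop _ P hP).1, ?_⟩
          simp only [hno, exists_false, Set.ofPred_false]
          exact (hop _ P hP).2

theorem Algorithm.exists_step_of_run [DecidableEq Loc] {A : Algorithm n Loc Val Op Resp}
    {c : A.Config} {p : Fin n} {Q : Prog Loc Val (Resp × A.Local)} (h : c.run p = some Q) :
    ∃ e c', Event.proc e = p ∧ A.Step c e c' := by
  cases Q with
  | ret a => exact ⟨_, _, rfl, .res c p a.1 a.2 h⟩
  | step l i k => exact ⟨_, _, rfl, .step c p l i k h⟩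

theorem Algorithm.stepComplexityLE_of_depth [DecidableEq Loc] {A : Algorithm n Loc Val Op Resp}
    {K : List (Event n Loc Val Op Resp) → Prop} {Q : Op → Prop} {B : ℝ}
    (h : ∀ op, Q op → ∃ (N : ℕ) (ok : Loc → Prop), (N : ℝ) ≤ B ∧
      ∀ s, ∀ P ∈ A.code op s, P.Depth N ∧ P.RawFree ok ∅) : A.StepComplexityLE K Q B := by
  intro E c hE _ i p op hi hQ
  obtain ⟨N, ok, hN, hop⟩ := h op hQ
  obtain ⟨h1, -, h3⟩ := Algorithm.static_of_exec ok N hE hi hop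
  refine ⟨le_trans (by exact_mod_cast h1) hN, fun hc => ?_⟩
  obtain ⟨P, hP, -⟩ := h3 (pending_of_not_complete hi hc)
  exact exists_step_of_run hP

end Generic

/-! ### Step bounds and read-after-write freedom of the WS-MULT code. -/

section Static

variable {α β : Type}

/-! ### Static properties of the code -/

theorem maxRead_of_le {k : ℕ} (h : k ≤ 1) (v : List Bool) : maxRead k v = .ret 0 := by
  rw [maxRead, dif_pos h]
  rfl

/-- The continuation is carried along so that inductions on `k` can vary it: in the right subtree it
has to absorb the shift of the result. -/
theorem maxRead_bind_of_lt {k : ℕ} (h : 1 < k) (v : List Bool) (f : ℕ → Code α) :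
    (maxRead k v).bind f = .step (.switch v) .read fun s : Bool =>
      if s = true then (maxRead (k / 2) (v ++ [true])).bind fun x => f (x + (k + 1) / 2)
      else (maxRead ((k + 1) / 2) (v ++ [false])).bind f := by
  rw [maxRead, dif_neg (by omega)]
  refine congrArg (Prog.step (Val := Val) (.switch v) .read) (funext fun s : Bool => ?_)
  cases s
  · rfl
  · exact Prog.bind_assoc (maxRead (k / 2) (v ++ [true])) (fun x => .ret (x + (k + 1) / 2)) f

theorem maxWrite_bind_of_le {k : ℕ} (h : k ≤ 1) (v : List Bool) (x : ℕ) (f : Unit → Code α) :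
    (maxWrite k v x).bind f = f () := by
  rw [maxWrite, dif_pos h]
  rfl

theorem maxWrite_bind_left {k : ℕ} (h : 1 < k) (v : List Bool) {x : ℕ} (hx : x < (k + 1) / 2)
    (f : Unit → Code α) :
    (maxWrite k v x).bind f = .step (.switch v) .read fun s : Bool =>
      if s = true then f () else (maxWrite ((k + 1) / 2) (v ++ [false]) x).bind f := by
  rw [maxWrite, dif_neg (by omega), if_pos hx]
  refine congrArg (Prog.step (Val := Val) (.switch v) .read) (funext fun s : Bool => ?_)
  cases s <;> rfl

/-- The write of the switch joins the continuation: along a path, switches are set from the bottom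
upwards. -/
theorem maxWrite_bind_right {k : ℕ} (h : 1 < k) (v : List Bool) {x : ℕ} (hx : ¬ x < (k + 1) / 2)
    (f : Unit → Code α) :
    (maxWrite k v x).bind f = (maxWrite (k / 2) (v ++ [true]) (x - (k + 1) / 2)).bind
      fun _ => .step (.switch v) (.write true) f := by
  rw [maxWrite, dif_neg (by omega), if_neg hx]
  exact Prog.bind_assoc _ _ _

theorem exists_line_of_mem_takeCode {m : ℕ} {o : LineOrder} {tail : ℕ} {P : Code (Resp × ℕ)}
    (hP : P ∈ takeCode m o tail) : ∃ line : ℕ → Code (Option ℕ+ × Unit),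
      (∀ head, line head ∈ o.line (readTask head) (headWrite m (head + 1))) ∧
      P = (maxRead (m + 1) []).bind fun r =>
        if r + 1 ≤ tail then (line (r + 1)).bind fun y => .ret (Resp.val y.1, tail)
        else .ret (Resp.empty, tail) := by
  obtain ⟨line, hl, rfl⟩ := hP
  exact ⟨line, hl, Prog.bind_assoc (maxRead (m + 1) []) (fun x => .ret (x + 1)) _⟩

theorem stealCode_eq (m s : ℕ) :
    stealCode m s = (maxRead (m + 1) []).bind fun r =>
      .step (.task (r + 1)) .read fun x : Option ℕ+ => match x with
        | none => .ret (Resp.empty, s)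
        | some y => (maxWrite (m + 1) [] (r + 1)).bind fun _ => .ret (Resp.val (some y), s) :=
  Prog.bind_assoc (maxRead (m + 1) []) (fun x => .ret (x + 1)) _

/-- One switch is read per level, and the larger half has `⌈k/2⌉` values, which is the recursion of
`Nat.clog 2`. -/
theorem depth_maxRead (k : ℕ) (v : List Bool) : (maxRead k v).Depth (Nat.clog 2 k) := by
  induction k using Nat.strong_induction_on generalizing v with
  | _ k ih =>
    rcases Nat.lt_or_ge 1 k with h | h
    · rw [← Prog.bind_ret (maxRead k v), maxRead_bind_of_lt h, Nat.clog_of_two_le (by norm_num) h]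
      rintro (_ | _)
      · exact (Prog.bind_ret _).symm ▸ ih _ (by omega) _
      · refine Prog.Depth.bind (b := 0) ((ih (k / 2) (by omega) _).mono ?_) fun _ => trivial
        exact Nat.clog_mono_right 2 (by omega)
    · rw [maxRead_of_le h]
      trivial

theorem depth_maxWrite (k : ℕ) (v : List Bool) (x : ℕ) :
    (maxWrite k v x).Depth (Nat.clog 2 k) := by
  induction k using Nat.strong_induction_on generalizing v x with
  | _ k ih =>
    rw [← Prog.bind_ret (maxWrite k v x)]
    rcases Nat.lt_or_ge 1 k with h | h
    · rw [Nat.clog_of_two_le (by norm_num) h]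
      by_cases hx : x < (k + 1) / 2
      · rw [maxWrite_bind_left h v hx]
        rintro (_ | _)
        · exact (Prog.bind_ret _).symm ▸ ih _ (by omega) _ _
        · trivial
      · rw [maxWrite_bind_right h v hx]
        refine Prog.Depth.bind ((ih (k / 2) (by omega) _ _).mono ?_) fun _ _ => Prog.depth_ret _ 0
        exact Nat.clog_mono_right 2 (by omega)
    · rw [maxWrite_bind_of_le h]
      trivial

theorem rawFree_maxRead_bind (ok : Loc → Prop) (k : ℕ) (v : List Bool) {f : ℕ → Code α}
    (hf : ∀ x, (f x).RawFree ok ∅) : ((maxRead k v).bind f).RawFree ok ∅ := by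
  induction k using Nat.strong_induction_on generalizing v f with
  | _ k ih =>
    rcases Nat.lt_or_ge 1 k with h | h
    · rw [maxRead_bind_of_lt h]
      refine ⟨by simp, fun s => ?_⟩
      simp only [reduceCtorEq, exists_false, and_false, Set.ofPred_false, Set.union_empty]
      cases s
      · exact ih _ (by omega) _ hf
      · exact ih _ (by omega) _ fun _ => hf _
    · rw [maxRead_of_le h]
      exact hf 0

/-- All reads happen on the way down and all writes on the way back up. The continuation must cope
with any set of written objects, since that set depends on the path. -/
theorem rawFree_maxWrite_bind (ok : Loc → Prop) (k : ℕ) (v : List Bool) (x : ℕ) {f : Unit → Code α}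
    (hf : ∀ S, (f ()).RawFree ok S) : ((maxWrite k v x).bind f).RawFree ok ∅ := by
  induction k using Nat.strong_induction_on generalizing v x f with
  | _ k ih =>
    rcases Nat.lt_or_ge 1 k with h | h
    · by_cases hx : x < (k + 1) / 2
      · rw [maxWrite_bind_left h v hx]
        refine ⟨by simp, fun s => ?_⟩
        simp only [reduceCtorEq, exists_false, and_false, Set.ofPred_false, Set.union_empty]
        cases s
        · exact ih _ (by omega) _ _ hf
        · exact hf ∅
      · rw [maxWrite_bind_right h v hx]
        exact ih _ (by omega) _ _ fun S => ⟨by simp, fun _ => hf _⟩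
    · rw [maxWrite_bind_of_le h]
      exact hf ∅

end Static

namespace Prog

variable {Loc : Type} {Val : Loc → Type} {α β γ : Type}

theorem rawFree_of_ok {ok : Loc → Prop} (h : ∀ l, ok l) (P : Prog Loc Val α) (S : Set Loc) :
    P.RawFree ok S := by
  induction P generalizing S with
  | ret => trivial
  | step l i k ih => exact ⟨fun _ _ _ _ => h l, fun x => ih x _⟩

theorem rawFree_bind_ret {ok : Loc → Prop} {P : Prog Loc Val α} {S : Set Loc} (h : P.RawFree ok S)
    (f : α → β) : (P.bind fun x => ret (f x)).RawFree ok S := by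
  induction P generalizing S with
  | ret => trivial
  | step l i k ih => exact ⟨h.1, fun x => ih x (h.2 x)⟩

/-- Every step of the program is a read of an object that satisfies `ok`. -/
def OnlyReads (ok : Loc → Prop) : Prog Loc Val α → Prop
  | ret _ => True
  | step l i k => (i = .read ∧ ok l) ∧ ∀ x, (k x).OnlyReads ok

theorem OnlyReads.rawFree {ok : Loc → Prop} {P : Prog Loc Val α} (h : P.OnlyReads ok)
    (S : Set Loc) : P.RawFree ok S := by
  induction P generalizing S with
  | ret => trivial
  | step l i k ih => exact ⟨fun _ _ _ _ => h.1.2, fun x => ih x (h.2 x) _⟩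

/-- The reads of `P` are exempted by `ok`, and `P` writes nothing, so it adds no obligations to the
reads of `Q`. -/
theorem Interleave.rawFree {ok : Loc → Prop} {P : Prog Loc Val α} {Q : Prog Loc Val β}
    {R : Prog Loc Val (α × β)} (h : Interleave P Q R) {S : Set Loc} (hP : P.OnlyReads ok)
    (hQ : Q.RawFree ok S) : R.RawFree ok S := by
  induction h generalizing S with
  | left_done x Q => exact rawFree_bind_ret hQ _
  | right_done P x => exact rawFree_bind_ret (hP.rawFree S) _
  | left_step l i k Q r h ih =>
    refine ⟨fun _ _ _ _ => hP.1.2, fun x => ?_⟩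
    have := ih x (hP.2 x) hQ
    simpa [hP.1.1] using this
  | right_step l i P k r h ih => exact ⟨hQ.1, fun x => ih x hP (hQ.2 x)⟩

end Prog

section Static

theorem depth_of_mem_putCode {o : LineOrder} {x : ℕ+} {tail : ℕ} {P : Code (Resp × ℕ)}
    (hP : P ∈ putCode o x tail) : P.Depth 2 := by
  obtain ⟨line, hl, rfl⟩ := hP
  exact (Prog.Interleave.depth (LineOrder.interleave hl) (a := 1) (b := 1) (fun _ => trivial) fun _ => trivial).bind
    fun _ => Prog.depth_ret _ 0

theorem depth_of_mem_takeCode {m : ℕ} {o : LineOrder} {tail : ℕ} {P : Code (Resp × ℕ)}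
    (hP : P ∈ takeCode m o tail) : P.Depth (2 * Nat.clog 2 (m + 1) + 1) := by
  obtain ⟨line, hl, rfl⟩ := hP
  have : (headRead m).Depth (Nat.clog 2 (m + 1)) :=
    (depth_maxRead _ _).bind fun _ => Prog.depth_ret _ 0
  refine (this.bind (b := 1 + Nat.clog 2 (m + 1)) fun head => ?_).mono (by omega)
  split_ifs
  · exact (Prog.Interleave.depth (LineOrder.interleave (hl head)) (a := 1) (fun _ => trivial) (depth_maxWrite _ _ _)).bind
      fun _ => Prog.depth_ret _ 0
  · trivial

theorem depth_stealCode (m s : ℕ) : (stealCode m s).Depth (2 * Nat.clog 2 (m + 1) + 1) := by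
  have : (headRead m).Depth (Nat.clog 2 (m + 1)) :=
    (depth_maxRead _ _).bind fun _ => Prog.depth_ret _ 0
  refine (this.bind (b := Nat.clog 2 (m + 1) + 1) fun head => ?_).mono (by omega)
  rintro (_ | y)
  · trivial
  · exact (depth_maxWrite _ _ _).bind fun _ => Prog.depth_ret _ 0

theorem rawFree_of_mem_takeCode {m : ℕ} {o : LineOrder} {tail : ℕ} {P : Code (Resp × ℕ)}
    (hP : P ∈ takeCode m o tail) :
    P.RawFree (fun l => o = .anyOrder ∧ ∃ head, l = .task head) ∅ := by
  obtain ⟨line, hl, rfl⟩ := exists_line_of_mem_takeCode hP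
  refine rawFree_maxRead_bind _ _ _ fun head => ?_
  split_ifs
  · refine Prog.rawFree_bind_ret (f := fun y : Option ℕ+ × Unit => (Resp.val y.1, tail)) ?_
    cases o with
    | asListed =>
      have h : line (head + 1) = _ := hl (head + 1)
      rw [h]
      refine ⟨by simp, fun x => ?_⟩
      simp only [reduceCtorEq, exists_false, and_false, Set.ofPred_false, Set.union_empty]
      exact rawFree_maxWrite_bind _ _ _ _ fun _ => trivial
    | anyOrder =>
      refine (hl (head + 1)).rawFree ⟨⟨rfl, rfl, _, rfl⟩, fun _ => trivial⟩ ?_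
      have := rawFree_maxWrite_bind (fun l => LineOrder.anyOrder = .anyOrder ∧ ∃ head, l = .task head)
        (m + 1) [] (head + 1) (f := Prog.ret) fun _ => trivial
      rwa [Prog.bind_ret] at this
  · trivial

theorem rawFree_stealCode (m s : ℕ) : (stealCode m s).RawFree (fun _ => False) ∅ := by
  rw [stealCode_eq]
  refine rawFree_maxRead_bind _ _ _ fun head => ?_
  refine ⟨by simp, fun x => ?_⟩
  simp only [reduceCtorEq, exists_false, and_false, Set.ofPred_false, Set.union_empty]
  cases x with
  | none => trivial
  | some y => exact rawFree_maxWrite_bind _ _ _ _ fun _ => trivial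

/-- With `L = Nat.log 2 m`, the left side is at most `2 * L + 3`. Both `L * log 2` and `log 2` are
at most `log (m + 1)`, so `5 / log 2 < 10` suffices. -/
theorem clog_le_mul_log {m : ℕ} (hm : 1 ≤ m) :
    ((2 * Nat.clog 2 (m + 1) + 1 : ℕ) : ℝ) ≤ 10 * Real.log (m + 1) := by
  have hlog2 := Real.log_two_gt_d9
  have hm' : (2 : ℝ) ≤ m + 1 := by
    have : (1 : ℝ) ≤ m := by exact_mod_cast hm
    linarith
  have h1 : Real.log 2 ≤ Real.log (m + 1) := Real.log_le_log (by norm_num) hm'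
  have h2 : Nat.clog 2 (m + 1) ≤ Nat.log 2 m + 1 := by
    rw [← Nat.clog_pow 2 (Nat.log 2 m + 1) (by norm_num)]
    exact Nat.clog_mono_right 2 (Nat.lt_pow_succ_log_self (by norm_num) m)
  have h3 : (Nat.log 2 m : ℝ) * Real.log 2 ≤ Real.log (m + 1) := by
    rw [← Real.log_pow]
    refine Real.log_le_log (by positivity) ?_
    have := Nat.pow_log_le_self 2 (x := m) (by omega)
    have : ((2 ^ Nat.log 2 m : ℕ) : ℝ) ≤ m := by exact_mod_cast this
    push_cast at this
    linarith
  have h4 : (Nat.clog 2 (m + 1) : ℝ) ≤ Nat.log 2 m + 1 := by exact_mod_cast h2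
  push_cast
  have h5 : (0 : ℝ) ≤ Nat.log 2 m := by positivity
  nlinarith

end Static

/-! ### Insertions and removals as functions of the list of events. -/

section Traces

variable {n : ℕ}

/-! ### The inserted and the removed tasks of an execution -/

/-- The smallest value and the number of values of the subtree that the path `v` leads to from a
node with smallest value `s.1` and `s.2` values. -/
def subnode (s : ℕ × ℕ) (v : List Bool) : ℕ × ℕ :=
  v.foldl (fun s b => if b then (s.1 + (s.2 + 1) / 2, s.2 / 2) else (s.1, (s.2 + 1) / 2)) s

/-- The smallest value and the number of values of the subtree at a node of the max register with
the values `0, ..., m`. -/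
def node (m : ℕ) (v : List Bool) : ℕ × ℕ := subnode (0, m + 1) v

/-- The smallest value of the right subtree of a node. -/
def threshold (m : ℕ) (v : List Bool) : ℕ := (node m v).1 + ((node m v).2 + 1) / 2

/-- The task that an event writes into `Tasks`. -/
def putVal : Event n Loc Val Op Resp → Option ℕ+
  | .step _ (.task _) (.write x) => x
  | _ => none

/-- The value of the max register that the switch set by an event stands for. -/
def newHead (m : ℕ) : Event n Loc Val Op Resp → ℕ
  | .step _ (.switch v) (.write _) => threshold m v
  | _ => 0

/-- All tasks inserted so far. -/
def inserted (E : List (Event n Loc Val Op Resp)) : List ℕ+ := E.filterMap putVal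

/-- The number of tasks removed so far. -/
def removed (m : ℕ) (E : List (Event n Loc Val Op Resp)) : ℕ :=
  E.foldl (fun k e => max k (newHead m e)) 0

theorem inserted_snoc (E : List (Event n Loc Val Op Resp)) (e) :
    inserted (E ++ [e]) = inserted E ++ (putVal e).toList := by
  simp only [inserted, List.filterMap_append]
  cases h : putVal e <;> simp [h]

theorem removed_snoc (m : ℕ) (E : List (Event n Loc Val Op Resp)) (e) :
    removed m (E ++ [e]) = max (removed m E) (newHead m e) := by
  simp [removed]

/-- Whenever `p` removes a task after time `i`, it is the `k`-th one. -/
def RemovesOnly (m : ℕ) (E : List (Event n Loc Val Op Resp)) (i : ℕ) (p : Fin n) (k : ℕ) : Prop :=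
  ∀ t e, i < t → E[t]? = some e → e.proc = p → removed m (E.take t) < newHead m e →
    removed m (E.take t) = k

/-- The process `p` does not remove any task after time `i`. -/
def RemovesNone (m : ℕ) (E : List (Event n Loc Val Op Resp)) (i : ℕ) (p : Fin n) : Prop :=
  ∀ t e, i < t → E[t]? = some e → e.proc = p → newHead m e ≤ removed m (E.take t)

/-- The operation invoked by `p` at `i` may return the task `x`. -/
def MayReturn (m : ℕ) (E : List (Event n Loc Val Op Resp)) (i : ℕ) (p : Fin n) (x : ℕ+) : Prop :=
  ∃ k, removed m (E.take i) ≤ k ∧ k < removed m E ∧ (inserted E)[k]? = some x ∧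
    RemovesOnly m E i p k

/-- The operation invoked by `p` at `i` may return `r`. -/
def ResponseOK (m : ℕ) (E : List (Event n Loc Val Op Resp)) (i : ℕ) (p : Fin n) (r : Resp) :
    Op → Prop
  | .put _ => r = .ok ∧ ∃ t e, i < t ∧ E[t]? = some e ∧ e.proc = p ∧ putVal e ≠ none
  | .take => (r = .empty ∧ removed m E = (inserted E).length ∧ RemovesNone m E i p) ∨
      ∃ x, r = .val (some x) ∧ MayReturn m E i p x
  | .steal => (r = .empty ∧ RemovesNone m E i p ∧ ∃ t l, i < t ∧
        E[t]? = some (.step p l .read) ∧ removed m (E.take t) = (inserted (E.take t)).length) ∨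
      ∃ x, r = .val (some x) ∧ MayReturn m E i p x

/-- The properties of an event `e` after the trace `E` on which set-linearizability rests. -/
def EventOK (m : ℕ) (E : List (Event n Loc Val Op Resp)) : Event n Loc Val Op Resp → Prop
  | .inv p op => (∀ i op', ¬ Pending E i p op') ∧ (p.val ≠ 0 ↔ op = .steal)
  | .step p l a => a.IsReadWrite ∧
      (∀ x, putVal (.step p l a : Event n Loc Val Op Resp) = some x → ∃ i, Pending E i p (.put x) ∧
        (inserted (E.take i)).length = (inserted E).length) ∧
      (removed m E < newHead m (.step p l a : Event n Loc Val Op Resp) →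
        newHead m (.step p l a : Event n Loc Val Op Resp) = removed m E + 1 ∧
        removed m E < (inserted E).length ∧
        ∃ i op, Pending E i p op ∧ (op = .take ∨ op = .steal) ∧
          RemovesOnly m E i p (removed m E))
  | .res p r => ∃ i op, Pending E i p op ∧ ResponseOK m E i p r op

/-- All events of the trace have the properties above. -/
def TraceOK (m : ℕ) (E : List (Event n Loc Val Op Resp)) : Prop :=
  ∀ t e, E[t]? = some e → EventOK m (E.take t) e

/-! ### Traces and their prefixes -/

theorem take_succ_of_getElem? {γ : Type*} {E : List γ} {t : ℕ} {e : γ} (h : E[t]? = some e) :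
    E.take (t + 1) = E.take t ++ [e] := by
  rw [List.take_add_one, h]
  rfl

theorem getElem?_take_eq_some {γ : Type*} {E : List γ} {t i : ℕ} {e : γ} :
    (E.take t)[i]? = some e ↔ i < t ∧ E[i]? = some e := by
  rw [List.getElem?_take]
  split_ifs with h <;> simp [h]

theorem pending_take {E : List (Event n Loc Val Op Resp)} {t i : ℕ} {p : Fin n} {op : Op} :
    Pending (E.take t) i p op ↔ i < t ∧ E[i]? = some (.inv p op) ∧
      ∀ j, i < j → j < t → ∀ r, E[j]? ≠ some (.res p r) := by
  simp only [Pending, ne_eq, getElem?_take_eq_some]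
  constructor
  · rintro ⟨⟨h1, h2⟩, h3⟩
    exact ⟨h1, h2, fun j h4 h5 r h6 => h3 j h4 r ⟨h5, h6⟩⟩
  · rintro ⟨h1, h2, h3⟩
    exact ⟨⟨h1, h2⟩, fun j h4 r h6 => h3 j h4 h6.1 r h6.2⟩

theorem inserted_take_succ {E : List (Event n Loc Val Op Resp)} {t : ℕ} {e}
    (h : E[t]? = some e) :
    inserted (E.take (t + 1)) = inserted (E.take t) ++ (putVal e).toList := by
  rw [take_succ_of_getElem? h, inserted_snoc]

theorem removed_take_succ {m : ℕ} {E : List (Event n Loc Val Op Resp)} {t : ℕ} {e}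
    (h : E[t]? = some e) :
    removed m (E.take (t + 1)) = max (removed m (E.take t)) (newHead m e) := by
  rw [take_succ_of_getElem? h, removed_snoc]

theorem removed_append_ge (m : ℕ) (E F : List (Event n Loc Val Op Resp)) :
    removed m E ≤ removed m (E ++ F) := by
  induction F using List.reverseRecOn with
  | nil => simp
  | append_singleton F e ih =>
    rw [← List.append_assoc, removed_snoc]
    exact ih.trans (le_max_left _ _)

theorem removed_take_mono (m : ℕ) (E : List (Event n Loc Val Op Resp)) {s t : ℕ} (h : s ≤ t) :
    removed m (E.take s) ≤ removed m (E.take t) := by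
  obtain ⟨F, hF⟩ := List.take_prefix_take_left (l := E) h
  rw [← hF]
  exact removed_append_ge m _ _

theorem removed_take_le (m : ℕ) (E : List (Event n Loc Val Op Resp)) (t : ℕ) :
    removed m (E.take t) ≤ removed m E := by
  conv_rhs => rw [← List.take_append_drop t E]
  exact removed_append_ge m _ _

theorem inserted_take_prefix (E : List (Event n Loc Val Op Resp)) {s t : ℕ} (h : s ≤ t) :
    inserted (E.take s) <+: inserted (E.take t) :=
  (List.take_prefix_take_left (l := E) h).filterMap _

theorem inserted_take_prefix_self (E : List (Event n Loc Val Op Resp)) (t : ℕ) :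
    inserted (E.take t) <+: inserted E :=
  (List.take_prefix t E).filterMap _

theorem TraceOK.snoc {m : ℕ} {E : List (Event n Loc Val Op Resp)} {e} (h : TraceOK m E)
    (he : EventOK m E e) : TraceOK m (E ++ [e]) := by
  intro t e' ht
  rcases getElem?_snoc_eq_some.1 ht with ht | ⟨rfl, rfl⟩
  · rw [List.take_append_of_le_length (lt_length_of_getElem? ht).le]
    exact h t e' ht
  · simpa using he

end Traces

/-! ### Candidate linearization points and their uniqueness. -/

section Linearization

variable {n m : ℕ} {E : List (Event n Loc Val Op Resp)}

/-! ### Consequences of the trace properties -/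

theorem getElem?_of_prefix {γ : Type*} {l l' : List γ} (h : l <+: l') {k : ℕ} {x : γ}
    (hx : l[k]? = some x) : l'[k]? = some x := by
  obtain ⟨s, rfl⟩ := h
  rw [List.getElem?_append_left (lt_length_of_getElem? hx), hx]

theorem inv_unique {i t : ℕ} {p p' : Fin n} {op op' : Op} (h : E[i]? = some (.inv p op))
    (h' : Pending (E.take t) i p' op') : p' = p ∧ op' = op := by
  have := h.symm.trans (pending_take.1 h').2.1
  simp only [Option.some.injEq, Event.inv.injEq] at this
  exact ⟨this.1.symm, this.2.symm⟩

theorem Returns.pending {i j : ℕ} {p : Fin n} {r : Resp} (h : Returns E i j p r) :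
    ∃ op, Pending (E.take j) i p op := by
  obtain ⟨⟨op, hi⟩, hij, hj, h⟩ := h
  exact ⟨op, pending_take.2 ⟨hij, hi, h⟩⟩

theorem Returns.unique {i j j' : ℕ} {p p' : Fin n} {r r' : Resp} (h : Returns E i j p r)
    (h' : Returns E i j' p' r') : j = j' ∧ p = p' ∧ r = r' := by
  obtain ⟨⟨op, hi⟩, hij, hj, h⟩ := h
  obtain ⟨⟨op', hi'⟩, hij', hj', h'⟩ := h'
  obtain ⟨rfl, rfl⟩ : p = p' ∧ op = op' := by
    have := hi.symm.trans hi'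
    simpa using this
  obtain rfl : j = j' := by
    rcases lt_trichotomy j j' with hlt | heq | hlt
    · exact absurd hj (h' j hij hlt r)
    · exact heq
    · exact absurd hj' (h j' hij' hlt r')
  have := hj.symm.trans hj'
  simp only [Option.some.injEq, Event.res.injEq, true_and] at this
  exact ⟨rfl, rfl, this⟩

theorem Returns.pending_iff {i j t : ℕ} {p p' : Fin n} {op : Op} {r : Resp}
    (h : Returns E i j p r) (ht : Pending (E.take t) i p' op) : t ≤ j := by
  obtain ⟨⟨op', hi⟩, hij, hj, h⟩ := h
  obtain ⟨h1, h2, h3⟩ := pending_take.1 ht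
  have := hi.symm.trans h2
  simp only [Option.some.injEq, Event.inv.injEq] at this
  obtain ⟨rfl, rfl⟩ := this
  by_contra hlt
  exact h3 j hij (by omega) r hj

theorem Pending.of_take_le {i s t : ℕ} {p : Fin n} {op : Op} (h : Pending (E.take t) i p op)
    (his : i < s) (hst : s ≤ t) : Pending (E.take s) i p op := by
  obtain ⟨h1, h2, h3⟩ := pending_take.1 h
  exact pending_take.2 ⟨his, h2, fun j hj hjs => h3 j hj (by omega)⟩

/-- The later of two pending operations of one process would have been invoked while the earlier one
was pending, which `EventOK` forbids. -/
theorem TraceOK.pending_unique (h : TraceOK m E) {i i' t : ℕ} {p : Fin n} {op op' : Op}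
    (h1 : Pending (E.take t) i p op) (h2 : Pending (E.take t) i' p op') : i = i' ∧ op = op' := by
  have key : ∀ {i i' op op'}, Pending (E.take t) i p op → Pending (E.take t) i' p op' →
      ¬ i < i' := by
    intro i i' op op' h1 h2 hlt
    have h3 := pending_take.1 h2
    exact (h i' _ h3.2.1).1 i op (h1.of_take_le hlt h3.1.le)
  obtain rfl : i = i' := le_antisymm (not_lt.1 (key h2 h1)) (not_lt.1 (key h1 h2))
  exact ⟨rfl, (pending_unique_inv h1.1 h2).2.symm⟩

theorem TraceOK.responseOK (h : TraceOK m E) {i j : ℕ} {p : Fin n} {r : Resp} {op : Op}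
    (hr : Returns E i j p r) (hi : E[i]? = some (.inv p op)) :
    ResponseOK m (E.take j) i p r op := by
  obtain ⟨op', h1⟩ := hr.pending
  obtain ⟨i', op'', h2, h3⟩ : ∃ i op, Pending (E.take j) i p op ∧ ResponseOK m (E.take j) i p r op :=
    h j _ hr.2.2.1
  obtain ⟨rfl, rfl⟩ := h.pending_unique h1 h2
  have := hi.symm.trans (pending_take.1 h1).2.1
  simp only [Option.some.injEq, Event.inv.injEq, true_and] at this
  rwa [this]

theorem TraceOK.removed_le (h : TraceOK m E) (t : ℕ) :
    removed m (E.take t) ≤ (inserted (E.take t)).length := by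
  induction t with
  | zero => simp [removed]
  | succ t ih =>
    cases he : E[t]? with
    | none =>
      rw [List.getElem?_eq_none_iff] at he
      rwa [List.take_of_length_le (by omega), ← List.take_of_length_le he]
    | some e =>
      rw [removed_take_succ he, inserted_take_succ he, List.length_append]
      rcases lt_or_ge (removed m (E.take t)) (newHead m e) with hlt | hge
      · obtain ⟨h1, h2⟩ : newHead m e = removed m (E.take t) + 1 ∧
            removed m (E.take t) < (inserted (E.take t)).length := by
          have := h t e he
          cases e with
          | inv => simp [newHead] at hlt
          | res => simp [newHead] at hlt
          | step p l a => exact ⟨(this.2.2 hlt).1, (this.2.2 hlt).2.1⟩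
        omega
      · omega

theorem TraceOK.removed_succ_le (h : TraceOK m E) (t : ℕ) :
    removed m (E.take (t + 1)) ≤ removed m (E.take t) + 1 := by
  cases he : E[t]? with
  | none =>
    rw [List.getElem?_eq_none_iff] at he
    rw [List.take_of_length_le (by omega), List.take_of_length_le he]
    omega
  | some e =>
    rw [removed_take_succ he]
    rcases lt_or_ge (removed m (E.take t)) (newHead m e) with hlt | hge
    · have := h t e he
      cases e with
      | inv => simp [newHead] at hlt
      | res => simp [newHead] at hlt
      | step p l a =>
        have := (this.2.2 hlt).1
        omega
    · omega

/-- A discrete intermediate value argument: `removed` grows by at most one per event, so it leaves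
the value `k` at some event in between. -/
theorem TraceOK.exists_removal (h : TraceOK m E) {i j k : ℕ} (hj : j ≤ E.length)
    (hik : removed m (E.take i) ≤ k) (hkj : k < removed m (E.take j)) :
    ∃ t e, i ≤ t ∧ t < j ∧ E[t]? = some e ∧ removed m (E.take t) = k ∧ k < newHead m e := by
  have hij : i ≤ j := by
    by_contra hlt
    have := removed_take_mono m E (not_le.1 hlt).le
    omega
  induction j, hij using Nat.le_induction with
  | base => omega
  | succ j hij ih =>
    rcases lt_or_ge k (removed m (E.take j)) with hlt | hge
    · obtain ⟨t, e, h1, h2, h3⟩ := ih (by omega) hlt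
      exact ⟨t, e, h1, by omega, h3⟩
    · have hje : E[j]? = some E[j] := List.getElem?_eq_getElem (by omega)
      have h1 := removed_take_succ (m := m) hje
      have h2 := h.removed_succ_le j
      exact ⟨j, _, hij, by omega, hje, by omega, by omega⟩

/-! ### Linearization points -/

/-- The event at `t` may serve as linearization point of the operation `op` of `p` at `i` with
response `r`. -/
inductive LinPointOf (m : ℕ) (E : List (Event n Loc Val Op Resp)) (i t : ℕ) (p : Fin n) :
    Op → Resp → Prop
  | put (x : ℕ+) (e) (he : E[t]? = some e) (hp : e.proc = p) (hx : putVal e = some x) :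
      LinPointOf m E i t p (.put x) .ok
  | remover (op : Op) (e) (x : ℕ+) (hop : op = .take ∨ op = .steal) (he : E[t]? = some e)
      (hrem : removed m (E.take t) < newHead m e)
      (hx : (inserted E)[removed m (E.take t)]? = some x) (hp : e.proc = p) :
      LinPointOf m E i t p op (.val (some x))
  | returns (op : Op) (e) (x : ℕ+) (j : ℕ) (hop : op = .take ∨ op = .steal) (he : E[t]? = some e)
      (hrem : removed m (E.take t) < newHead m e)
      (hx : (inserted E)[removed m (E.take t)]? = some x) (hr : Returns E i j p (.val (some x)))
      (honly : RemovesOnly m (E.take j) i p (removed m (E.take t))) :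
      LinPointOf m E i t p op (.val (some x))
  | takeEmpty (he : E[t]? = some (.res p .empty))
      (hempty : removed m (E.take t) = (inserted (E.take t)).length) :
      LinPointOf m E i t p .take .empty
  | stealEmpty (l : Loc) (j : ℕ) (he : E[t]? = some (.step p l .read))
      (hempty : removed m (E.take t) = (inserted (E.take t)).length)
      (hr : Returns E i j p .empty) :
      LinPointOf m E i t p .steal .empty

/-- The event at `t` may serve as linearization point of the operation at `i`, with response
`r`. -/
def LinPoint (m : ℕ) (E : List (Event n Loc Val Op Resp)) (i t : ℕ) (r : Resp) : Prop :=
  ∃ p op, Pending (E.take t) i p op ∧ LinPointOf m E i t p op r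

theorem not_read_of_newHead_pos {e : Event n Loc Val Op Resp} {k : ℕ} (h : k < newHead m e) :
    ∃ p l v, e = .step p l (.write v) := by
  unfold newHead at h
  split at h
  · exact ⟨_, _, _, rfl⟩
  · omega

theorem write_of_putVal {e : Event n Loc Val Op Resp} {x : ℕ+} (h : putVal e = some x) :
    ∃ p i v, e = .step p (.task i) (.write v) := by
  match e, h with
  | .step p (.task i) (.write v), _ => exact ⟨p, i, v, rfl⟩

theorem TraceOK.put_pending (h : TraceOK m E) {t : ℕ} {e} (he : E[t]? = some e) {x : ℕ+}
    (hx : putVal e = some x) : ∃ i, Pending (E.take t) i e.proc (.put x) ∧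
      (inserted (E.take i)).length = (inserted (E.take t)).length := by
  obtain ⟨p, l, v, rfl⟩ := write_of_putVal hx
  obtain ⟨i, h1, h2⟩ := (h t _ he).2.1 x hx
  refine ⟨i, h1, ?_⟩
  rwa [List.take_take, min_eq_left (pending_take.1 h1).1.le] at h2

theorem TraceOK.remover_pending (h : TraceOK m E) {t : ℕ} {e} (he : E[t]? = some e)
    (hrem : removed m (E.take t) < newHead m e) :
    newHead m e = removed m (E.take t) + 1 ∧
        removed m (E.take t) < (inserted (E.take t)).length ∧
        ∃ i op, Pending (E.take t) i e.proc op ∧ (op = .take ∨ op = .steal) ∧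
          RemovesOnly m (E.take t) i e.proc (removed m (E.take t)) := by
  obtain ⟨p, l, v, rfl⟩ := not_read_of_newHead_pos hrem
  exact (h t _ he).2.2 hrem

theorem Returns.lt_of_step {i j t : ℕ} {p p' q : Fin n} {op : Op} {r : Resp} {l : Loc}
    {a : Instr (Val l)} (h : Returns E i j p r) (ht : Pending (E.take t) i p' op)
    (he : E[t]? = some (.step q l a)) : t < j := by
  refine lt_of_le_of_ne (h.pending_iff ht) ?_
  rintro rfl
  have := h.2.2.1.symm.trans he
  simp at this

theorem RemovesOnly.eq {i j t k : ℕ} {e} (h : RemovesOnly m (E.take j) i e.proc k) (hit : i < t)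
    (htj : t < j) (he : E[t]? = some e) (hrem : removed m (E.take t) < newHead m e) :
    removed m (E.take t) = k := by
  have := h t e hit (getElem?_take_eq_some.2 ⟨htj, he⟩) rfl
  rw [List.take_take, min_eq_left htj.le] at this
  exact this hrem

theorem RemovesNone.not_lt {i j t : ℕ} {e} (h : RemovesNone m (E.take j) i e.proc) (hit : i < t)
    (htj : t < j) (he : E[t]? = some e) : ¬ removed m (E.take t) < newHead m e := by
  have := h t e hit (getElem?_take_eq_some.2 ⟨htj, he⟩) rfl
  rw [List.take_take, min_eq_left htj.le] at this
  omega

theorem removed_lt_removed {s t : ℕ} {e} (he : E[s]? = some e) (hst : s < t)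
    (hrem : removed m (E.take s) < newHead m e) : removed m (E.take s) < removed m (E.take t) := by
  have h1 := removed_take_mono m E (show s + 1 ≤ t from hst)
  rw [removed_take_succ he] at h1
  omega

/-- The only case that is not immediate is an operation linearized at its own removal: `RemovesNone`
excludes the response `empty`, and `RemovesOnly` forces the task it returned to be the one it
removed. -/
theorem LinPoint.response (h : TraceOK m E) {i t j : ℕ} {r r' : Resp} {p : Fin n}
    (hl : LinPoint m E i t r) (hr : Returns E i j p r') : r = r' := by
  obtain ⟨p', op, hp, hl⟩ := hl
  have hpt := pending_take.1 hp
  obtain rfl : p' = p := by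
    obtain ⟨op', hi⟩ := hr.1
    exact (inv_unique hi hp).1
  have hok := h.responseOK hr hpt.2.1
  cases hl with
  | put => exact hok.1.symm
  | remover _ e x hop he hrem hx hproc =>
    subst hproc
    obtain ⟨q, l, v, rfl⟩ := not_read_of_newHead_pos hrem
    have htj := hr.lt_of_step hp he
    have : ∃ y, r' = .val (some y) ∧ MayReturn m (E.take j) i q y := by
      rcases hop with rfl | rfl
      · rcases hok with ⟨-, -, h3⟩ | h3
        · exact absurd hrem (h3.not_lt hpt.1 htj he)
        · exact h3
      · rcases hok with ⟨-, h3, -⟩ | h3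
        · exact absurd hrem (h3.not_lt hpt.1 htj he)
        · exact h3
    obtain ⟨y, rfl, k, -, -, hy, honly⟩ := this
    obtain rfl := RemovesOnly.eq honly hpt.1 htj he hrem
    have := hx.symm.trans (getElem?_of_prefix (inserted_take_prefix_self E j) hy)
    rw [Option.some.inj this]
  | returns _ e x j' hop he hrem hx hr' => exact (hr'.unique hr).2.2
  | takeEmpty he =>
    have : Returns E i t p' .empty := ⟨⟨_, hpt.2.1⟩, hpt.1, he, hpt.2.2⟩
    exact (this.unique hr).2.2
  | stealEmpty l j' he hempty hr' => exact (hr'.unique hr).2.2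

/-- For a returned task, its number `k` is not yet removed at the invocation and removed at the
response, so its removal falls between the two. -/
theorem TraceOK.exists_linPoint (h : TraceOK m E) {i j : ℕ} {r : Resp} {p : Fin n}
    (hr : Returns E i j p r) : ∃ t, LinPoint m E i t r := by
  obtain ⟨op, hp⟩ := hr.pending
  have hpt := pending_take.1 hp
  have hj := lt_length_of_getElem? hr.2.2.1
  have hok := h.responseOK hr hpt.2.1
  have hval : ∀ x, (op = .take ∨ op = .steal) → r = .val (some x) →
      MayReturn m (E.take j) i p x → ∃ t, LinPoint m E i t r := by
    rintro x hop rfl ⟨k, h1, h2, h3, h4⟩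
    rw [List.take_take, min_eq_left hpt.1.le] at h1
    obtain ⟨t, e, hit, htj, he, rfl, hrem⟩ := h.exists_removal hj.le h1 h2
    have hit : i < t := by
      refine lt_of_le_of_ne hit ?_
      rintro rfl
      obtain ⟨q, l, v, rfl⟩ := not_read_of_newHead_pos hrem
      have := hpt.2.1.symm.trans he
      simp at this
    exact ⟨t, p, op, hp.of_take_le hit htj.le, .returns op e x j hop he hrem
      (getElem?_of_prefix (inserted_take_prefix_self E j) h3) hr h4⟩
  cases op with
  | put x =>
    obtain ⟨rfl, t, e, hit, he, hproc, hput⟩ := hok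
    obtain ⟨htj, he⟩ := getElem?_take_eq_some.1 he
    obtain ⟨y, hy⟩ := Option.ne_none_iff_exists'.1 hput
    obtain ⟨i', hi', -⟩ := h.put_pending he hy
    have hp' := hp.of_take_le hit htj.le
    rw [hproc] at hi'
    obtain ⟨rfl, hop⟩ := h.pending_unique hp' hi'
    cases hop
    exact ⟨t, p, _, hp', .put _ e he hproc hy⟩
  | take =>
    rcases hok with ⟨rfl, h1, -⟩ | ⟨x, h1, h2⟩
    -- The response event itself is the linearization point: there the owner knows that the queue is
    -- empty.
    · exact ⟨j, p, _, hp, .takeEmpty hr.2.2.1 h1⟩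
    · exact hval x (Or.inl rfl) h1 h2
  | steal =>
    rcases hok with ⟨rfl, -, t, l, hit, he, h1⟩ | ⟨x, h1, h2⟩
    · obtain ⟨htj, he⟩ := getElem?_take_eq_some.1 he
      rw [List.take_take, min_eq_left htj.le] at h1
      exact ⟨t, p, _, hp.of_take_le hit htj.le, .stealEmpty l j he h1 hr⟩
    · exact hval x (Or.inr rfl) h1 h2

/-- A `Put` inserts only if nothing has been inserted since its invocation, so a second insertion by
the same `Put` is impossible. -/
theorem LinPoint.eq_of_putVal (h : TraceOK m E) {i t t' : ℕ} {e x} {r : Resp}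
    (he : E[t]? = some e) (hx : putVal e = some x) (hp : Pending (E.take t) i e.proc (.put x))
    (hlen : (inserted (E.take i)).length = (inserted (E.take t)).length)
    (hl : LinPoint m E i t' r) : t' = t := by
  obtain ⟨p, op, hp', hl⟩ := hl
  have hpt := pending_take.1 hp
  obtain ⟨rfl, rfl⟩ := inv_unique hpt.2.1 hp'
  have key : ∀ {s s' : ℕ} {e x}, E[s]? = some e → putVal e = some x → s < s' →
      (inserted (E.take s)).length < (inserted (E.take s')).length := by
    intro s s' e x he hx hss
    have h1 := (inserted_take_prefix E (show s + 1 ≤ s' from hss)).length_le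
    rw [inserted_take_succ he, hx] at h1
    simp only [List.length_append, Option.toList_some, List.length_singleton] at h1
    omega
  cases hl with
  | put _ e' he' hproc hx' =>
    obtain ⟨i', hi', hlen'⟩ := h.put_pending he' hx'
    rw [hproc] at hi'
    obtain ⟨rfl, -⟩ := h.pending_unique hp' hi'
    rcases lt_trichotomy t' t with hlt | heq | hlt
    · have := key he' hx' hlt
      omega
    · exact heq
    · have := key he hx hlt
      omega
  | remover _ _ _ hop => simp at hop
  | returns _ _ _ _ hop => simp at hop

/-- An operation that removes a task has no other choice of linearization point, even if an equal
task is removed elsewhere in its interval. This guarantees that the class at each removal is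
nonempty. -/
theorem LinPoint.eq_of_remover (h : TraceOK m E) {i t t' : ℕ} {e} {op : Op} {r : Resp}
    (he : E[t]? = some e) (hrem : removed m (E.take t) < newHead m e)
    (hp : Pending (E.take t) i e.proc op) (hop : op = .take ∨ op = .steal)
    (honly : RemovesOnly m (E.take t) i e.proc (removed m (E.take t)))
    (hl : LinPoint m E i t' r) : t' = t := by
  obtain ⟨p, op', hp', hl⟩ := hl
  have hpt := pending_take.1 hp
  have hpt' := pending_take.1 hp'
  obtain ⟨hpp, rfl⟩ := inv_unique hpt.2.1 hp'
  obtain ⟨q, l, v, rfl⟩ := not_read_of_newHead_pos hrem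
  have hnone : ∀ {j}, Returns E i j q .empty → False := by
    intro j hr
    have htj := hr.lt_of_step hp he
    have hok := h.responseOK hr hpt.2.1
    rcases hop with rfl | rfl
    · rcases hok with ⟨-, -, h3⟩ | ⟨x, h3, -⟩
      · exact h3.not_lt hpt.1 htj he hrem
      · cases h3
    · rcases hok with ⟨-, h3, -⟩ | ⟨x, h3, -⟩
      · exact h3.not_lt hpt.1 htj he hrem
      · cases h3
  -- The number of removed tasks determines the removal event, since it increases strictly at each
  -- removal.
  have heq : ∀ {e'}, E[t']? = some e' → removed m (E.take t') < newHead m e' →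
      removed m (E.take t') = removed m (E.take t) → t' = t := by
    intro e' he' hrem' hk
    rcases lt_trichotomy t' t with hlt | heq | hlt
    · have := removed_lt_removed he' hlt hrem'
      omega
    · exact heq
    · have := removed_lt_removed he hlt hrem
      omega
  cases hl with
  | put => simp at hop
  | remover _ e' _ _ he' hrem' _ hproc' =>
    rcases lt_trichotomy t' t with hlt | heq | hlt
    · have hq : e'.proc = (Event.step q l (.write v) : Event n Loc Val Op Resp).proc :=
        hproc'.trans hpp
      rw [← hq] at honly
      exact heq he' hrem' (honly.eq hpt'.1 hlt he' hrem')
    · exact heq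
    · obtain ⟨-, -, i', op'', h1, -, h3⟩ := h.remover_pending he' hrem'
      have hq : e'.proc = (Event.step q l (.write v) : Event n Loc Val Op Resp).proc :=
        hproc'.trans hpp
      rw [hproc'] at h1
      obtain ⟨rfl, -⟩ := h.pending_unique hp' h1
      rw [hq] at h3
      exact heq he' hrem' (h3.eq hpt.1 hlt he hrem).symm
  | returns _ e' x j _ he' hrem' hx hr honly' =>
    have htj := hr.lt_of_step hp he
    rw [hpp] at honly'
    exact heq he' hrem' (RemovesOnly.eq honly' hpt.1 htj he hrem).symm
  | takeEmpty he' =>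
    have hr : Returns E i t' p .empty := ⟨⟨_, hpt'.2.1⟩, hpt'.1, he', hpt'.2.2⟩
    exact (hnone (hpp ▸ hr)).elim
  | stealEmpty _ j _ _ hr => exact (hnone (hpp ▸ hr)).elim

end Linearization

/-! ### Classes, labels and the set-sequential run. -/

section Linearization

variable {n m : ℕ} {E : List (Event n Loc Val Op Resp)}

/-! ### The linearization -/

open Classical in
/-- The linearization point and the response chosen for the operation at `i`. -/
noncomputable def chosenPoint (m : ℕ) (E : List (Event n Loc Val Op Resp)) (i : ℕ) :
    Option (ℕ × Resp) :=
  if h : ∃ s : ℕ × Resp, LinPoint m E i s.1 s.2 then some h.choose else none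

open Classical in
/-- The operations that are linearized at `t`. -/
noncomputable def classAt (m : ℕ) (E : List (Event n Loc Val Op Resp)) (t : ℕ) : Finset ℕ :=
  (Finset.range E.length).filter fun i => ∃ r, chosenPoint m E i = some (t, r)

/-- The operation invoked at `i`. -/
def opAt (E : List (Event n Loc Val Op Resp)) (i : ℕ) : Op :=
  match E[i]? with
  | some (.inv _ op) => op
  | _ => .take

/-- The response of the operation at `i` in the linearization. -/
noncomputable def outAt (m : ℕ) (E : List (Event n Loc Val Op Resp)) (i : ℕ) : Resp :=
  match chosenPoint m E i with
  | some (_, r) => r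
  | none => .ok

/-- The concurrency class linearized at `t`. -/
noncomputable def labelsAt (m : ℕ) (E : List (Event n Loc Val Op Resp)) (t : ℕ) :
    Multiset (Op × Resp) :=
  (classAt m E t).val.map fun i => (opAt E i, outAt m E i)

theorem opAt_eq {i : ℕ} {p : Fin n} {op : Op} (h : E[i]? = some (.inv p op)) : opAt E i = op := by
  simp [opAt, h]

theorem linPoint_of_chosenPoint {i t : ℕ} {r : Resp} (h : chosenPoint m E i = some (t, r)) :
    LinPoint m E i t r := by
  unfold chosenPoint at h
  split_ifs at h with h'
  have := h'.choose_spec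
  rwa [Option.some.inj h] at this

theorem linPoint_of_mem_classAt {i t : ℕ} (h : i ∈ classAt m E t) :
    LinPoint m E i t (outAt m E i) := by
  classical
  obtain ⟨r, hr⟩ := (Finset.mem_filter.1 h).2
  have : outAt m E i = r := by simp [outAt, hr]
  rw [this]
  exact linPoint_of_chosenPoint hr

theorem exists_classAt {i t : ℕ} {r : Resp} (h : LinPoint m E i t r) :
    ∃ t', i ∈ classAt m E t' := by
  classical
  obtain ⟨p, op, hp, -⟩ := id h
  have hi := lt_length_of_getElem? (pending_take.1 hp).2.1
  have h' : ∃ s : ℕ × Resp, LinPoint m E i s.1 s.2 := ⟨(t, r), h⟩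
  refine ⟨h'.choose.1, Finset.mem_filter.2 ⟨Finset.mem_range.2 hi, h'.choose.2, ?_⟩⟩
  rw [chosenPoint, dif_pos h']

/-- The point is chosen arbitrarily among the candidates, so membership in a prescribed class needs
that there is only one candidate. -/
theorem mem_classAt_of_unique {i t : ℕ} {r : Resp} (h : LinPoint m E i t r)
    (hu : ∀ t' r', LinPoint m E i t' r' → t' = t) : i ∈ classAt m E t := by
  obtain ⟨t', ht'⟩ := exists_classAt h
  obtain rfl := hu t' _ (linPoint_of_mem_classAt ht')
  exact ht'

theorem disjoint_classAt {t t' : ℕ} (h : t ≠ t') : Disjoint (classAt m E t) (classAt m E t') := by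
  classical
  rw [Finset.disjoint_left]
  intro i hi hi'
  obtain ⟨r, hr⟩ := (Finset.mem_filter.1 hi).2
  obtain ⟨r', hr'⟩ := (Finset.mem_filter.1 hi').2
  have := hr.symm.trans hr'
  simp only [Option.some.injEq, Prod.mk.injEq] at this
  exact h this.1

theorem labelsAt_eq_singleton {i t : ℕ} {op : Op} {r : Resp} (hi : i ∈ classAt m E t)
    (hu : ∀ i' ∈ classAt m E t, i' = i) (hop : opAt E i = op) (hr : outAt m E i = r) :
    labelsAt m E t = {(op, r)} := by
  have : classAt m E t = {i} := Finset.eq_singleton_iff_unique_mem.2 ⟨hi, hu⟩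
  rw [labelsAt, this, ← hop, ← hr]
  rfl

/-- All members of the class are pending at the same time, so they belong to different processes: at
most one is the owner's `Take`, and at most `n - 1` are `Steal`s. -/
theorem multStep_of_labels (h : TraceOK m E) {C : Finset ℕ} {t : ℕ} {x : ℕ+} {q : List ℕ+}
    {out : ℕ → Resp} (hC : C.Nonempty)
    (hmem : ∀ i ∈ C, out i = .val (some x) ∧
      ∃ p op, Pending (E.take t) i p op ∧ (op = .take ∨ op = .steal)) :
    MultStep n (x :: q) (C.val.map fun i => (opAt E i, out i)) q := by
  classical
  set T := C.filter fun i => opAt E i = .take with hT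
  set S := C.filter fun i => ¬ opAt E i = .take with hS
  have hT' : ∀ i ∈ T, ∃ p : Fin n, p.val = 0 ∧ Pending (E.take t) i p .take := by
    intro i hi
    obtain ⟨hi, hop⟩ := Finset.mem_filter.1 hi
    obtain ⟨-, p, op, hp, -⟩ := hmem i hi
    have hinv := (pending_take.1 hp).2.1
    obtain rfl : op = .take := (opAt_eq hinv).symm.trans hop
    refine ⟨p, ?_, hp⟩
    by_contra h0
    exact absurd ((h i _ hinv).2.1 h0) (by simp)
  have hS' : ∀ i ∈ S, opAt E i = .steal ∧
      ∃ p : Fin n, p.val ≠ 0 ∧ Pending (E.take t) i p .steal := by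
    intro i hi
    obtain ⟨hi, hop⟩ := Finset.mem_filter.1 hi
    obtain ⟨-, p, op, hp, hop'⟩ := hmem i hi
    have hinv := (pending_take.1 hp).2.1
    rw [opAt_eq hinv] at hop ⊢
    obtain rfl := hop'.resolve_left hop
    exact ⟨rfl, p, (h i _ hinv).2.2 rfl, hp⟩
  have hTcard : T.card ≤ 1 := by
    rw [Finset.card_le_one]
    intro i hi i' hi'
    obtain ⟨p, hp, h1⟩ := hT' i hi
    obtain ⟨p', hp', h2⟩ := hT' i' hi'
    obtain rfl : p = p' := Fin.ext (hp.trans hp'.symm)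
    exact (h.pending_unique h1 h2).1
  have hScard : S.card ≤ n - 1 := by
    obtain ⟨i0, hi0⟩ := hC
    have : Nonempty (Fin n) := ⟨(hmem i0 hi0).2.choose⟩
    choose! g hg using fun i hi => (hS' i hi).2
    have : S.card ≤ (Finset.range (n - 1)).card := by
      -- Thieves have the numbers `1, ..., n - 1`; subtracting one maps them injectively into `range
      -- (n - 1)`.
      refine Finset.card_le_card_of_injOn (fun i => (g i).val - 1) ?_ ?_
      · intro i hi
        have := (hg i hi).1
        have := (g i).isLt
        simp only [Finset.coe_range, Set.mem_Iio]
        omega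
      · intro i hi i' hi' heq
        have h1 := hg i hi
        have h2 := hg i' hi'
        have heq : (g i).val - 1 = (g i').val - 1 := heq
        have : g i = g i' := Fin.ext (by omega)
        rw [this] at h1
        exact (h.pending_unique h1.2 h2.2).1
    simpa using this
  have hsum : C.val.map (fun i => (opAt E i, out i)) =
      Multiset.replicate T.card (Op.take, Resp.val (some x)) +
        Multiset.replicate S.card (Op.steal, Resp.val (some x)) := by
    rw [← Multiset.filter_add_not (fun i => opAt E i = .take) C.val, Multiset.map_add]
    congr 1
    · rw [Finset.card_def, ← Multiset.map_const']
      refine Multiset.map_congr rfl fun i hi => ?_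
      have hi : i ∈ T := hi
      obtain ⟨hi, hop⟩ := Finset.mem_filter.1 hi
      rw [hop, (hmem i hi).1]
    · rw [Finset.card_def, ← Multiset.map_const']
      refine Multiset.map_congr rfl fun i hi => ?_
      have hi : i ∈ S := hi
      rw [(hS' i hi).1, (hmem i (Finset.mem_filter.1 hi).1).1]
  have hpos : 1 ≤ T.card + S.card := by
    rw [hT, hS, Finset.card_filter_add_card_filter_not]
    exact hC.card_pos
  rw [hsum]
  obtain h0 | h1 : T.card = 0 ∨ T.card = 1 := by omega
  · rw [h0, Multiset.replicate_zero, zero_add]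
    exact .steal q x _ (by omega) hScard
  · rw [h1, Multiset.replicate_one, Multiset.singleton_add]
    exact .take q x _ hScard

/-- Only removals are shared by several processes; any other event linearizes at most the pending
operation of its own process. -/
theorem LinPointOf.proc {i t : ℕ} {p : Fin n} {op : Op} {r : Resp} {e}
    (hl : LinPointOf m E i t p op r) (he : E[t]? = some e)
    (hrem : ¬ removed m (E.take t) < newHead m e) : e.proc = p := by
  cases hl with
  | put x e' he' hp hx => exact Option.some.inj (he.symm.trans he') ▸ hp
  | remover op e' x hop he' hrem' =>
    exact absurd (Option.some.inj (he.symm.trans he') ▸ hrem') hrem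
  | returns op e' x j hop he' hrem' =>
    exact absurd (Option.some.inj (he.symm.trans he') ▸ hrem') hrem
  | takeEmpty he' => exact Option.some.inj (he.symm.trans he') ▸ rfl
  | stealEmpty l j he' => exact Option.some.inj (he.symm.trans he') ▸ rfl

theorem newHead_of_putVal {e : Event n Loc Val Op Resp} {x : ℕ+} (h : putVal e = some x) :
    newHead m e = 0 := by
  obtain ⟨p, l, v, rfl⟩ := write_of_putVal h
  rfl

theorem putVal_of_newHead {e : Event n Loc Val Op Resp} {k : ℕ} (h : k < newHead m e) :
    putVal e = none := by
  cases hx : putVal e with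
  | none => rfl
  | some x =>
    rw [newHead_of_putVal hx] at h
    omega

/-- The state of the queue of tasks at time `t`. -/
def stateAt (m : ℕ) (E : List (Event n Loc Val Op Resp)) (t : ℕ) : List ℕ+ :=
  (inserted (E.take t)).drop (removed m (E.take t))

/-- An insertion appends a task, a removal drops the head, and any other event leaves the queue
unchanged, so an operation linearized there is an empty `Take` or `Steal` at an empty queue. At an
insertion or removal, the operation that performs the event lies in the class. -/
theorem TraceOK.stateAt_succ (h : TraceOK m E) {t : ℕ} (ht : t < E.length) :
    (classAt m E t = ∅ → stateAt m E (t + 1) = stateAt m E t) ∧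
    ((classAt m E t).Nonempty →
      MultStep n (stateAt m E t) (labelsAt m E t) (stateAt m E (t + 1))) := by
  obtain ⟨e, he⟩ : ∃ e, E[t]? = some e := ⟨_, List.getElem?_eq_getElem ht⟩
  have hle := h.removed_le t
  rw [stateAt, stateAt, inserted_take_succ he, removed_take_succ he]
  cases hx : putVal e with
  | some x =>
    obtain ⟨i, hi, hlen⟩ := h.put_pending he hx
    have hl : LinPoint m E i t .ok := ⟨_, _, hi, .put x e he rfl hx⟩
    have hmem := mem_classAt_of_unique hl fun t' r' hl' => hl'.eq_of_putVal h he hx hi hlen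
    refine ⟨fun h0 => absurd hmem (h0 ▸ Finset.notMem_empty i), fun _ => ?_⟩
    rw [newHead_of_putVal hx, max_eq_left (Nat.zero_le _), Option.toList_some,
      List.drop_append_of_le_length hle]
    have hu : ∀ i' ∈ classAt m E t, i' = i := by
      intro i' hi'
      obtain ⟨p, op, hp, hl'⟩ := linPoint_of_mem_classAt hi'
      have := hl'.proc he (by simp [newHead_of_putVal hx])
      exact (h.pending_unique (this ▸ hp) hi).1
    obtain ⟨p, op, hp, hl'⟩ := linPoint_of_mem_classAt hmem
    have hinv := (pending_take.1 hi).2.1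
    obtain ⟨-, rfl⟩ := inv_unique hinv hp
    have hout : outAt m E i = .ok := by
      generalize outAt m E i = r at hl'
      cases hl' with
      | put => rfl
      | remover _ _ _ hop => simp at hop
      | returns _ _ _ _ hop => simp at hop
    rw [labelsAt_eq_singleton hmem hu (opAt_eq hinv) hout]
    exact .put _ _
  | none =>
    rw [Option.toList_none, List.append_nil]
    by_cases hrem : removed m (E.take t) < newHead m e
    · obtain ⟨hnew, hlt, i, op, hi, hop, honly⟩ := h.remover_pending he hrem
      have hget : (inserted E)[removed m (E.take t)]? =
          some (inserted (E.take t))[removed m (E.take t)] :=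
        getElem?_of_prefix (inserted_take_prefix_self E t) (List.getElem?_eq_getElem hlt)
      -- The remover gets this point whether or not it ever responds.
      have hl : LinPoint m E i t _ := ⟨_, _, hi, .remover op e _ hop he hrem hget rfl⟩
      have hmem := mem_classAt_of_unique hl fun t' r' hl' =>
        hl'.eq_of_remover h he hrem hi hop honly
      refine ⟨fun h0 => absurd hmem (h0 ▸ Finset.notMem_empty i), fun hne => ?_⟩
      rw [hnew, max_eq_right (Nat.le_succ _), List.drop_eq_getElem_cons hlt]
      refine multStep_of_labels h (t := t) hne fun i' hi' => ?_
      obtain ⟨p, op', hp, hl'⟩ := linPoint_of_mem_classAt hi'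
      have key : outAt m E i' = .val (some (inserted (E.take t))[removed m (E.take t)]) ∧
          (op' = .take ∨ op' = .steal) := by
        obtain ⟨q, l, v, rfl⟩ := not_read_of_newHead_pos hrem
        generalize outAt m E i' = r at hl'
        cases hl' with
        | put x e' he' hp hx' =>
          obtain rfl := Option.some.inj (he.symm.trans he')
          rw [putVal_of_newHead hrem] at hx'
          cases hx'
        | remover _ _ _ hop' _ _ hx' =>
          rw [Option.some.inj (hget.symm.trans hx')]
          exact ⟨rfl, hop'⟩
        | returns _ _ _ _ hop' _ _ hx' =>
          rw [Option.some.inj (hget.symm.trans hx')]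
          exact ⟨rfl, hop'⟩
        | takeEmpty he' => cases he.symm.trans he'
        | stealEmpty l j he' => cases he.symm.trans he'
      exact ⟨key.1, p, op', hp, key.2⟩
    · rw [max_eq_left (not_lt.1 hrem)]
      refine ⟨fun _ => rfl, fun ⟨i, hi⟩ => ?_⟩
      obtain ⟨p, op, hp, hl⟩ := linPoint_of_mem_classAt hi
      have hproc := hl.proc he hrem
      have hu : ∀ i' ∈ classAt m E t, i' = i := by
        intro i' hi'
        obtain ⟨p', op', hp', hl'⟩ := linPoint_of_mem_classAt hi'
        obtain rfl := (hl'.proc he hrem).symm.trans hproc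
        exact (h.pending_unique hp' hp).1
      have key : removed m (E.take t) = (inserted (E.take t)).length ∧ outAt m E i = .empty ∧
          (op = .take ∨ op = .steal) := by
        generalize outAt m E i = r at hl
        cases hl with
        | put x e' he' hp hx' =>
          obtain rfl := Option.some.inj (he.symm.trans he')
          rw [hx] at hx'
          cases hx'
        | remover op e' x hop he' hrem' =>
          exact absurd (Option.some.inj (he.symm.trans he') ▸ hrem') hrem
        | returns op e' x j hop he' hrem' =>
          exact absurd (Option.some.inj (he.symm.trans he') ▸ hrem') hrem
        | takeEmpty he' h1 => exact ⟨h1, rfl, Or.inl rfl⟩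
        | stealEmpty l j he' h1 => exact ⟨h1, rfl, Or.inr rfl⟩
      rw [labelsAt_eq_singleton hi hu (opAt_eq (pending_take.1 hp).2.1) key.2.1, key.1,
        List.drop_length]
      rcases key.2.2 with rfl | rfl
      · exact .takeEmpty
      · exact .stealEmpty

open Classical in
/-- The events at which operations are linearized. -/
noncomputable def points (m : ℕ) (E : List (Event n Loc Val Op Resp)) (s : ℕ) : List ℕ :=
  (List.range' s (E.length - s)).filter fun t => (classAt m E t).Nonempty

theorem TraceOK.runs (h : TraceOK m E) (s : ℕ) :
    (multSpec n).Runs (stateAt m E s) ((points m E s).map (labelsAt m E)) := by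
  classical
  induction hk : E.length - s generalizing s with
  | zero =>
    rw [points, hk]
    trivial
  | succ k ih =>
    have hs := h.stateAt_succ (t := s) (by omega)
    have ih := ih (s + 1) (by omega)
    rw [points, show E.length - (s + 1) = k by omega] at ih
    rw [points, hk, List.range'_succ]
    rcases (classAt m E s).eq_empty_or_nonempty with h0 | h1
    · rw [List.filter_cons_of_neg (by simp [h0]), ← hs.1 h0]
      exact ih
    · rw [List.filter_cons_of_pos (by simp [h1])]
      exact ⟨_, hs.2 h1, ih⟩

/-- Classes are listed by the positions of their events. Each position lies after the invocation of
every member and not after its response, hence the order of non-overlapping operations is respected.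
-/
theorem TraceOK.setLinearizable (h : TraceOK m E) : SetLinearizable (multSpec n) E := by
  classical
  have hsorted : (points m E 0).Pairwise (· < ·) := List.Pairwise.filter _ (List.pairwise_lt_range' ..)
  refine ⟨(points m E 0).map (classAt m E), opAt E, outAt m E, ?_, ?_, ?_, ?_, ?_⟩
  · intro C hC i hi
    obtain ⟨t, -, rfl⟩ := List.mem_map.1 hC
    obtain ⟨p, op, hp, -⟩ := linPoint_of_mem_classAt hi
    have := (pending_take.1 hp).2.1
    exact ⟨p, (opAt_eq this).symm ▸ this⟩
  · exact List.pairwise_map.2 (hsorted.imp fun hlt => disjoint_classAt hlt.ne)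
  · intro i j p r hr
    obtain ⟨t, ht⟩ := h.exists_linPoint hr
    obtain ⟨t', ht'⟩ := exists_classAt ht
    have hl := linPoint_of_mem_classAt ht'
    refine ⟨⟨_, List.mem_map.2 ⟨t', ?_, rfl⟩, ht'⟩, hl.response h hr⟩
    have hlt : t' < E.length := by
      obtain ⟨p', op, hp, hl⟩ := hl
      have := hr.pending_iff hp
      have := lt_length_of_getElem? hr.2.2.1
      omega
    simp only [points, List.mem_filter, List.mem_range', decide_eq_true_eq]
    exact ⟨⟨t', by omega, by omega⟩, i, ht'⟩
  · intro a b C D hC hD i hi j hj ⟨s, p, r, hr, hsj⟩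
    rw [List.getElem?_map, Option.map_eq_some_iff] at hC hD
    obtain ⟨ta, hta, rfl⟩ := hC
    obtain ⟨tb, htb, rfl⟩ := hD
    obtain ⟨p1, op1, hp1, -⟩ := linPoint_of_mem_classAt hi
    obtain ⟨p2, op2, hp2, -⟩ := linPoint_of_mem_classAt hj
    have h1 := hr.pending_iff hp1
    have h2 := (pending_take.1 hp2).1
    by_contra hab
    obtain ⟨ha, rfl⟩ := List.getElem?_eq_some_iff.1 hta
    obtain ⟨hb, rfl⟩ := List.getElem?_eq_some_iff.1 htb
    rcases (not_lt.1 hab).eq_or_lt with rfl | hlt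
    · omega
    · have := List.pairwise_iff_getElem.1 hsorted b a hb ha hlt
      omega
  · have := h.runs 0
    rw [List.map_map]
    exact this

end Linearization

/-! ### Thresholds of the tree, and annotated remainders of the code. -/

section Phases

variable {m : ℕ}

/-! ### The nodes of the max register -/

theorem node_nil (m : ℕ) : node m [] = (0, m + 1) := rfl

theorem node_snoc_true {v : List Bool} {a k : ℕ} (h : node m v = (a, k)) :
    node m (v ++ [true]) = (a + (k + 1) / 2, k / 2) := by
  unfold node subnode at h ⊢
  rw [List.foldl_append, h]
  rfl

theorem node_snoc_false {v : List Bool} {a k : ℕ} (h : node m v = (a, k)) :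
    node m (v ++ [false]) = (a, (k + 1) / 2) := by
  unfold node subnode at h ⊢
  rw [List.foldl_append, h]
  rfl

theorem threshold_eq {v : List Bool} {a k : ℕ} (h : node m v = (a, k)) :
    threshold m v = a + (k + 1) / 2 := by
  rw [threshold, h]

/-- Both halves of a node with at least two values are nonempty, so its threshold lies strictly
inside its range, and ranges are nested along a path. -/
theorem subnode_bounds (v : List Bool) (s : ℕ × ℕ) (h : 2 ≤ (subnode s v).2) :
    2 ≤ s.2 ∧ s.1 < (subnode s v).1 + ((subnode s v).2 + 1) / 2 ∧
      (subnode s v).1 + ((subnode s v).2 + 1) / 2 < s.1 + s.2 := by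
  induction v generalizing s with
  | nil =>
    have h : 2 ≤ s.2 := h
    simp only [subnode, List.foldl_nil]
    omega
  | cons b v ih =>
    cases b
    · have := ih (s.1, (s.2 + 1) / 2) h
      change 2 ≤ (s.2 + 1) / 2 ∧ s.1 < _ ∧ _ < s.1 + (s.2 + 1) / 2 at this
      change 2 ≤ s.2 ∧ s.1 < _ ∧ (subnode (s.1, (s.2 + 1) / 2) v).1 + _ < s.1 + s.2
      refine ⟨by omega, this.2.1, lt_of_lt_of_le this.2.2 (by omega)⟩
    · have := ih (s.1 + (s.2 + 1) / 2, s.2 / 2) h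
      change 2 ≤ s.2 / 2 ∧ s.1 + (s.2 + 1) / 2 < _ ∧ _ < s.1 + (s.2 + 1) / 2 + s.2 / 2 at this
      change 2 ≤ s.2 ∧ s.1 < _ ∧ (subnode (s.1 + (s.2 + 1) / 2, s.2 / 2) v).1 + _ < s.1 + s.2
      refine ⟨by omega, lt_of_le_of_lt (by omega) this.2.1, lt_of_lt_of_le this.2.2 (by omega)⟩

/-- Thresholds are ordered as in a binary search tree: those in the left subtree are below that of
the root, and those in the right subtree above it. -/
theorem subnode_inj (v v' : List Bool) (s : ℕ × ℕ) (h : 2 ≤ (subnode s v).2)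
    (h' : 2 ≤ (subnode s v').2)
    (heq : (subnode s v).1 + ((subnode s v).2 + 1) / 2 =
      (subnode s v').1 + ((subnode s v').2 + 1) / 2) : v = v' := by
  have hf : ∀ w, 2 ≤ (subnode s (false :: w)).2 →
      (subnode s (false :: w)).1 + ((subnode s (false :: w)).2 + 1) / 2 < s.1 + (s.2 + 1) / 2 :=
    fun w hw => (subnode_bounds w (s.1, (s.2 + 1) / 2) hw).2.2
  have ht : ∀ w, 2 ≤ (subnode s (true :: w)).2 →
      s.1 + (s.2 + 1) / 2 < (subnode s (true :: w)).1 + ((subnode s (true :: w)).2 + 1) / 2 :=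
    fun w hw => (subnode_bounds w (s.1 + (s.2 + 1) / 2, s.2 / 2) hw).2.1
  have hn : (subnode s []).1 + ((subnode s []).2 + 1) / 2 = s.1 + (s.2 + 1) / 2 := rfl
  induction v generalizing v' s with
  | nil =>
    match v', h', heq with
    | [], _, _ => rfl
    | false :: w, h', heq =>
      have := hf w h'
      omega
    | true :: w, h', heq =>
      have := ht w h'
      omega
  | cons b v ih =>
    have key : ∀ s : ℕ × ℕ, ∀ v', 2 ≤ (subnode s v).2 → 2 ≤ (subnode s v').2 →
        (subnode s v).1 + ((subnode s v).2 + 1) / 2 =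
          (subnode s v').1 + ((subnode s v').2 + 1) / 2 → v = v' := fun s v' h h' heq =>
      ih v' s h h' heq (fun w hw => (subnode_bounds w (s.1, (s.2 + 1) / 2) hw).2.2)
        (fun w hw => (subnode_bounds w (s.1 + (s.2 + 1) / 2, s.2 / 2) hw).2.1) rfl
    match b, v', h, h', heq with
    | false, [], h, _, heq =>
      have := hf v h
      omega
    | true, [], h, _, heq =>
      have := ht v h
      omega
    | false, true :: w, h, h', heq =>
      have := hf v h
      have := ht w h'
      omega
    | true, false :: w, h, h', heq =>
      have := ht v h
      have := hf w h'
      omega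
    | false, false :: w, h, h', heq => rw [key _ _ h h' heq]
    | true, true :: w, h, h', heq => rw [key _ _ h h' heq]

theorem threshold_inj {v v' : List Bool} (h : 2 ≤ (node m v).2) (h' : 2 ≤ (node m v').2)
    (heq : threshold m v = threshold m v') : v = v' :=
  subnode_inj v v' (0, m + 1) h h' heq

/-! ### Phases of the operations -/

/-- Code that raises the max register to at least `X` if it is at least `b` before and `X ≤ b + 1`:
it sets only switches that stand for values up to `X`. -/
inductive Writes (m X : ℕ) : ℕ → Code Unit → Prop
  | done (b : ℕ) (h : X ≤ b) : Writes m X b (.ret ())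
  | readSwitch (v : List Bool) (b : ℕ) (F : Bool → Code Unit) (hv : 2 ≤ (node m v).2)
      (hf : Writes m X b (F false)) (ht : Writes m X (max b (threshold m v)) (F true)) :
      Writes m X b (.step (.switch v) .read F)
  | setSwitch (v : List Bool) (b : ℕ) (F : Unit → Code Unit) (hv : 2 ≤ (node m v).2)
      (hX : threshold m v ≤ X) (h : Writes m X (max b (threshold m v)) (F ())) :
      Writes m X b (.step (.switch v) (.write true) F)

/-- The rest of a `Take` or `Steal` that is going to return the `k`-th task (counted from 0), which
is `x` if `g = some x`, when the max register is at least `b`. -/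
inductive Claimed (m k s : ℕ) : ℕ → Option (Option ℕ+) → Code (Resp × ℕ) → Prop
  | done (b : ℕ) (x : Option ℕ+) (h : k + 1 ≤ b) : Claimed m k s b (some x) (.ret (.val x, s))
  | readSwitch (v : List Bool) (b : ℕ) (g : Option (Option ℕ+)) (F : Bool → Code (Resp × ℕ))
      (hv : 2 ≤ (node m v).2) (hf : Claimed m k s b g (F false))
      (ht : Claimed m k s (max b (threshold m v)) g (F true)) :
      Claimed m k s b g (.step (.switch v) .read F)
  | setSwitch (v : List Bool) (b : ℕ) (g : Option (Option ℕ+)) (F : Unit → Code (Resp × ℕ))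
      (hv : 2 ≤ (node m v).2) (hX : threshold m v ≤ k + 1)
      (h : Claimed m k s (max b (threshold m v)) g (F ())) :
      Claimed m k s b g (.step (.switch v) (.write true) F)
  | readTask (b : ℕ) (F : Option ℕ+ → Code (Resp × ℕ))
      (h : ∀ x, Claimed m k s b (some x) (F x)) :
      Claimed m k s b none (.step (.task (k + 1)) .read F)

/-- The rest of a `Take` or `Steal` that is searching for the value of the max register, which has
been at least `a` and less than `d`. -/
inductive Searching (m : ℕ) (op : Op) (s : ℕ) : ℕ → ℕ → Code (Resp × ℕ) → Prop
  | readSwitch (v : List Bool) (a d : ℕ) (F : Bool → Code (Resp × ℕ)) (hv : 2 ≤ (node m v).2)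
      (hf : Searching m op s a (threshold m v) (F false))
      (ht : Searching m op s (threshold m v) d (F true)) :
      Searching m op s a d (.step (.switch v) .read F)
  | claim (a : ℕ) (P : Code (Resp × ℕ)) (hop : op = .take) (ha : a + 1 ≤ s)
      (h : a < m → Claimed m a s a none P) : Searching m op s a (a + 1) P
  | takeEmpty (a : ℕ) (hop : op = .take) (ha : ¬ a + 1 ≤ s) :
      Searching m op s a (a + 1) (.ret (.empty, s))
  | stealTask (a : ℕ) (F : Option ℕ+ → Code (Resp × ℕ)) (hop : op = .steal)
      (hnone : F none = .ret (.empty, s))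
      (hsome : ∀ y, a < m → Claimed m a s a (some (some y)) (F (some y))) :
      Searching m op s a (a + 1) (.step (.task (a + 1)) .read F)

/-- The rest of a `Put`; the flags tell which of its two writes have been executed. -/
inductive Putting (x : ℕ+) (s : ℕ) : Bool → Bool → Code (Resp × ℕ) → Prop
  | done : Putting x s true true (.ret (.ok, s + 1))
  | writeTask (b : Bool) (F : Unit → Code (Resp × ℕ)) (h : Putting x s true b (F ())) :
      Putting x s false b (.step (.task (s + 1)) (.write (some x : Option ℕ+)) F)
  | writeBot (b : Bool) (F : Unit → Code (Resp × ℕ)) (h : Putting x s b true (F ())) :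
      Putting x s b false (.step (.task (s + 1 + 2)) (.write (none : Option ℕ+)) F)

/-- The bracket starts as the range of the node; a set switch raises its lower end and an unset one
lowers its upper end to the threshold, until one value remains at a leaf. -/
theorem searching_maxRead {op : Op} {s a k : ℕ} {v : List Bool} {f : ℕ → Code (Resp × ℕ)}
    (hv : node m v = (a, k)) (hk : 1 ≤ k)
    (hf : ∀ x < k, Searching m op s (a + x) (a + x + 1) (f x)) :
    Searching m op s a (a + k) ((maxRead k v).bind f) := by
  induction k using Nat.strong_induction_on generalizing v a f with
  | _ k ih =>
    rcases Nat.lt_or_ge 1 k with h | h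
    · rw [maxRead_bind_of_lt h]
      refine .readSwitch v _ _ _ (by rw [hv]; exact h) ?_ ?_
      · rw [threshold_eq hv]
        exact ih ((k + 1) / 2) (by omega) (node_snoc_false hv) (by omega)
          fun x hx => hf x (by omega)
      · have := ih (k / 2) (by omega) (node_snoc_true hv) (by omega)
          (f := fun x => f (x + (k + 1) / 2)) fun x hx => by
            have := hf (x + (k + 1) / 2) (by omega)
            rwa [show a + (x + (k + 1) / 2) = a + (k + 1) / 2 + x by omega] at this
        rw [show a + (k + 1) / 2 + k / 2 = a + k by omega] at this
        rw [threshold_eq hv]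
        exact this
    · obtain rfl : k = 1 := by omega
      rw [maxRead_of_le h]
      exact hf 0 (by omega)

theorem searching_maxRead_root {op : Op} {s : ℕ} {f : ℕ → Code (Resp × ℕ)}
    (hf : ∀ x, Searching m op s x (x + 1) (f x)) :
    Searching m op s 0 (m + 1) ((maxRead (m + 1) []).bind f) := by
  have := searching_maxRead (op := op) (s := s) (f := f) (node_nil m) (by omega) fun x _ => by
    rw [Nat.zero_add]
    exact hf x
  rwa [Nat.zero_add] at this

/-- The target `X` is established inside the subtree only for `0 < x`: the least value of a subtree
has its switch at an ancestor, so for `x = 0` no progress is promised to the continuation. -/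
theorem writes_maxWrite {X b a k x : ℕ} {v : List Bool} {f : Unit → Code Unit}
    (hv : node m v = (a, k)) (hx : x < k) (hX : a + x = X)
    (hf : ∀ b', b ≤ b' → (0 < x → X ≤ b') → Writes m X b' (f ())) :
    Writes m X b ((maxWrite k v x).bind f) := by
  induction k using Nat.strong_induction_on generalizing v a x f with
  | _ k ih =>
    rcases Nat.lt_or_ge 1 k with h | h
    · have hv2 : 2 ≤ (node m v).2 := by rw [hv]; exact h
      by_cases hx2 : x < (k + 1) / 2
      · rw [maxWrite_bind_left h v hx2]
        refine .readSwitch v _ _ hv2 ?_ ?_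
        · exact ih ((k + 1) / 2) (by omega) (node_snoc_false hv) hx2 hX hf
        -- The switch is set, so the register already exceeds `X` and the write may stop.
        · rw [threshold_eq hv]
          exact hf _ (le_max_left _ _) fun _ => le_max_of_le_right (by omega)
      · rw [maxWrite_bind_right h v hx2]
        refine ih (k / 2) (by omega) (node_snoc_true hv) (by omega) (by omega) fun b' hb' hX' => ?_
        refine .setSwitch v _ _ hv2 (by rw [threshold_eq hv]; omega) ?_
        rw [threshold_eq hv]
        refine hf _ (le_max_of_le_left hb') fun _ => ?_
        -- If the offset in the right subtree is positive, the recursive write has reached `X`; if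
        -- it is 0, then `X` is the threshold of this very switch.
        by_cases h0 : 0 < x - (k + 1) / 2
        · exact le_max_of_le_left (hX' h0)
        · exact le_max_of_le_right (by omega)
    · rw [maxWrite_bind_of_le h]
      exact hf b le_rfl (by omega)

theorem writes_headWrite {k : ℕ} (hk : k < m) : Writes m (k + 1) k (headWrite m (k + 1 + 1)) := by
  have := writes_maxWrite (m := m) (b := k) (f := Prog.ret) (node_nil m) (x := k + 1) (by omega)
    (Nat.zero_add _) fun b' _ h => .done b' (h (by omega))
  rwa [Prog.bind_ret] at this

theorem Writes.claimed {k s b : ℕ} {Q : Code Unit} (h : Writes m (k + 1) b Q) (x : Option ℕ+) :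
    Claimed m k s b (some x) (Q.bind fun _ => .ret (.val x, s)) := by
  induction h with
  | done b h => exact .done b x h
  | readSwitch v b F hv hf ht ihf iht => exact .readSwitch v b _ _ hv ihf iht
  | setSwitch v b F hv hX h ih => exact .setSwitch v b _ _ hv hX ih

/-- The read of `Tasks` and the write of `Head` do not interact: `g` records whether the read has
happened, and `b` how far the write has come. -/
theorem claimed_of_interleave {k s b : ℕ} {g : Option (Option ℕ+)} {P : Code (Option ℕ+)}
    {Q : Code Unit} {R : Code (Option ℕ+ × Unit)} (h : Prog.Interleave P Q R)
    (hP : (g = none ∧ P = readTask (k + 1)) ∨ ∃ x, g = some x ∧ P = .ret x)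
    (hQ : Writes m (k + 1) b Q) :
    Claimed m k s b g (R.bind fun y => .ret (.val y.1, s)) := by
  induction h generalizing g b with
  | left_done a Q =>
    rcases hP with ⟨-, hP⟩ | ⟨x, rfl, hP⟩
    · cases hP
    · cases hP
      rw [Prog.bind_assoc]
      exact hQ.claimed a
  | right_done P u =>
    cases hQ with
    | done _ hb =>
      rcases hP with ⟨rfl, rfl⟩ | ⟨x, rfl, rfl⟩
      · exact .readTask b _ fun x => .done b x hb
      · exact .done b x hb
  | left_step l i K Q r h ih =>
    rcases hP with ⟨rfl, hP⟩ | ⟨x, -, hP⟩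
    · cases hP
      exact .readTask b _ fun x => ih x (Or.inr ⟨x, rfl, rfl⟩) hQ
    · cases hP
  | right_step l i P K r h ih =>
    cases hQ with
    | readSwitch v _ F hv hf ht =>
      exact .readSwitch v b g _ hv (ih false hP hf) (ih true hP ht)
    | setSwitch v _ F hv hX h' => exact .setSwitch v b g _ hv hX (ih () hP h')

theorem searching_of_mem_takeCode {o : LineOrder} {s : ℕ} {P : Code (Resp × ℕ)}
    (hP : P ∈ takeCode m o s) : Searching m .take s 0 (m + 1) P := by
  obtain ⟨line, hl, rfl⟩ := exists_line_of_mem_takeCode hP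
  refine searching_maxRead_root fun x => ?_
  by_cases hx : x + 1 ≤ s
  · rw [if_pos hx]
    exact .claim x _ rfl hx fun hxm =>
      claimed_of_interleave (LineOrder.interleave (hl (x + 1))) (Or.inl ⟨rfl, rfl⟩)
        (writes_headWrite hxm)
  · rw [if_neg hx]
    exact .takeEmpty x rfl hx

theorem searching_stealCode (m s : ℕ) : Searching m .steal s 0 (m + 1) (stealCode m s) := by
  rw [stealCode_eq]
  refine searching_maxRead_root fun x => ?_
  exact .stealTask x _ rfl rfl fun y hxm => (writes_headWrite hxm).claimed (some y)

/-- Two flags suffice to describe all orders of the two writes. -/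
theorem putting_of_interleave {x : ℕ+} {s : ℕ} {b b' : Bool} {P Q : Code Unit}
    {R : Code (Unit × Unit)} (h : Prog.Interleave P Q R)
    (hP : (b = false ∧ P = writeTask (s + 1) (some x)) ∨ (b = true ∧ P = .ret ()))
    (hQ : (b' = false ∧ Q = writeTask (s + 1 + 2) none) ∨ (b' = true ∧ Q = .ret ())) :
    Putting x s b b' (R.bind fun _ => .ret (.ok, s + 1)) := by
  induction h generalizing b b' with
  | left_done a Q =>
    rcases hP with ⟨-, hP⟩ | ⟨rfl, -⟩
    · cases hP
    · rcases hQ with ⟨rfl, rfl⟩ | ⟨rfl, rfl⟩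
      · exact .writeBot _ _ .done
      · exact .done
  | right_done P u =>
    rcases hQ with ⟨-, hQ⟩ | ⟨rfl, -⟩
    · cases hQ
    · rcases hP with ⟨rfl, rfl⟩ | ⟨rfl, rfl⟩
      · exact .writeTask _ _ .done
      · exact .done
  | left_step l i K Q r h ih =>
    rcases hP with ⟨rfl, hP⟩ | ⟨-, hP⟩
    · cases hP
      exact .writeTask _ _ (ih () (Or.inr ⟨rfl, rfl⟩) hQ)
    · cases hP
  | right_step l i P K r h ih =>
    rcases hQ with ⟨rfl, hQ⟩ | ⟨-, hQ⟩
    · cases hQ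
      exact .writeBot _ _ (ih () hP (Or.inr ⟨rfl, rfl⟩))
    · cases hQ

theorem putting_of_mem_putCode {o : LineOrder} {x : ℕ+} {s : ℕ} {P : Code (Resp × ℕ)}
    (hP : P ∈ putCode o x s) : Putting x s false false P := by
  obtain ⟨line, hl, rfl⟩ := hP
  exact putting_of_interleave (LineOrder.interleave hl) (Or.inl ⟨rfl, rfl⟩) (Or.inl ⟨rfl, rfl⟩)

end Phases

/-! ### The invariant and its stability under events of other processes. -/

section Invariant

variable {n m : ℕ}

/-! ### The invariant -/

/-- The contents of an entry of `Tasks`. -/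
def taskOf (mem : (l : Loc) → Val l) (j : ℕ) : Option ℕ+ := mem (.task j)

/-- The contents of a switch. -/
def switchOf (mem : (l : Loc) → Val l) (v : List Bool) : Bool := mem (.switch v)

theorem taskOf_update_task (mem : (l : Loc) → Val l) (j j' : ℕ) (x : Option ℕ+) :
    taskOf (Function.update mem (.task j) x) j' = if j' = j then x else taskOf mem j' := by
  by_cases h : j' = j
  · subst h
    exact (Function.update_self (β := Val) _ _ _).trans (if_pos rfl).symm
  · exact (Function.update_of_ne (β := Val) (fun hc => h (by injection hc)) _ _).trans
      (if_neg h).symm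

theorem taskOf_update_switch (mem : (l : Loc) → Val l) (v : List Bool) (j : ℕ) (b : Bool) :
    taskOf (Function.update mem (.switch v) b) j = taskOf mem j :=
  Function.update_of_ne (by simp) _ _

theorem switchOf_update_task (mem : (l : Loc) → Val l) (j : ℕ) (v : List Bool) (x : Option ℕ+) :
    switchOf (Function.update mem (.task j) x) v = switchOf mem v :=
  Function.update_of_ne (by simp) _ _

theorem switchOf_update_switch (mem : (l : Loc) → Val l) (v v' : List Bool) (b : Bool) :
    switchOf (Function.update mem (.switch v) b) v' = if v' = v then b else switchOf mem v' := by
  by_cases h : v' = v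
  · subst h
    exact (Function.update_self (β := Val) _ _ _).trans (if_pos rfl).symm
  · exact (Function.update_of_ne (β := Val) (fun hc => h (by injection hc)) _ _).trans
      (if_neg h).symm

/-- The number of invocations of `Put`. -/
noncomputable def numPuts (E : List (Event n Loc Val Op Resp)) : ℕ :=
  Set.ncard {i : ℕ | ∃ p x, E[i]? = some (.inv p (Op.put x))}

theorem finite_puts (E : List (Event n Loc Val Op Resp)) :
    {i : ℕ | ∃ p x, E[i]? = some (.inv p (Op.put x))}.Finite :=
  (Set.finite_lt_nat E.length).subset fun _ ⟨_, _, h⟩ => lt_length_of_getElem? h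

theorem numPuts_le_snoc (E : List (Event n Loc Val Op Resp)) (e) :
    numPuts E ≤ numPuts (E ++ [e]) :=
  Set.ncard_le_ncard (fun _ ⟨p, x, h⟩ => ⟨p, x, getElem?_snoc_eq_some.2 (Or.inl h)⟩)
    (finite_puts _)

theorem numPuts_lt_snoc (E : List (Event n Loc Val Op Resp)) (p : Fin n) (x : ℕ+) :
    numPuts E < numPuts (E ++ [.inv p (.put x)]) := by
  refine Set.ncard_lt_ncard ⟨fun _ ⟨p, x, h⟩ => ⟨p, x, getElem?_snoc_eq_some.2 (Or.inl h)⟩,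
    fun h => ?_⟩ (finite_puts _)
  obtain ⟨q, y, hy⟩ := h (show E.length ∈ _ from ⟨p, x, getElem?_snoc_eq_some.2 (Or.inr ⟨rfl, rfl⟩)⟩)
  exact lt_irrefl _ (lt_length_of_getElem? hy)

/-- The shared memory after the trace `E`. -/
structure MemoryOK (m : ℕ) (E : List (Event n Loc Val Op Resp)) (mem : (l : Loc) → Val l) :
    Prop where
  removed_le : removed m E ≤ (inserted E).length
  task : ∀ k x, (inserted E)[k]? = some x → taskOf mem (k + 1) = some x
  bot : taskOf mem ((inserted E).length + 1) = none
  switch : ∀ v, 2 ≤ (node m v).2 → (switchOf mem v = true ↔ threshold m v ≤ removed m E)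

/-- The owner, with the value `s` of `tail`, is not executing `Put`. -/
structure OwnerQuiet (E : List (Event n Loc Val Op Resp)) (mem : (l : Loc) → Val l) (s : ℕ) :
    Prop where
  tail_eq : s = (inserted E).length
  bot : taskOf mem (s + 2) = none
  le_puts : (inserted E).length ≤ numPuts E

/-- The owner is executing `Put(x)`; the flags tell which writes have been executed. -/
structure PutPhase (E : List (Event n Loc Val Op Resp)) (mem : (l : Loc) → Val l) (s i : ℕ)
    (p : Fin n) (x : ℕ+) (P : Code (Resp × ℕ)) (b b' : Bool) : Prop where
  code : Putting x s b b' P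
  start : (inserted (E.take i)).length = s
  length_eq : (inserted E).length = s + b.toNat
  le_puts : s + 1 ≤ numPuts E
  bot : b = false → taskOf mem (s + 2) = none
  bot' : b' = true → taskOf mem (s + 3) = none
  written : b = true → ∃ t e, i < t ∧ E[t]? = some e ∧ e.proc = p ∧ putVal e ≠ none

/-- The progress of a pending `Take` or `Steal`. -/
inductive DequeuePhase (m : ℕ) (E : List (Event n Loc Val Op Resp)) (s i : ℕ) (p : Fin n)
    (op : Op) (P : Code (Resp × ℕ)) : Prop
  | searching (a d : ℕ) (code : Searching m op s a d P) (ha : a ≤ removed m E)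
      (hd : removed m (E.take i) < d) (hnone : RemovesNone m E i p)
  | claimed (k b : ℕ) (g : Option (Option ℕ+)) (code : Claimed m k s b g P)
      (hk : removed m (E.take i) ≤ k) (hkb : k ≤ b) (hb : b ≤ removed m E)
      (hlt : k < (inserted E).length) (hg : ∀ x, g = some x → (inserted E)[k]? = x)
      (honly : RemovesOnly m E i p k)
  | sawBot (hop : op = .steal) (code : P = .ret (.empty, s)) (hnone : RemovesNone m E i p)
      (hread : ∃ t l, i < t ∧ E[t]? = some (.step p l .read) ∧
        removed m (E.take t) = (inserted (E.take t)).length)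

/-- The progress of a pending operation. -/
def PhaseOK (m : ℕ) (E : List (Event n Loc Val Op Resp)) (mem : (l : Loc) → Val l) (s i : ℕ)
    (p : Fin n) (P : Code (Resp × ℕ)) : Op → Prop
  | .put x => ∃ b b', PutPhase E mem s i p x P b b'
  | .take => OwnerQuiet E mem s ∧ DequeuePhase m E s i p .take P
  | .steal => DequeuePhase m E s i p .steal P

/-- The state of the process `p`: `s` is its persistent variable and `run` the rest of its
program. -/
def ProcOK (m : ℕ) (E : List (Event n Loc Val Op Resp)) (mem : (l : Loc) → Val l) (s : ℕ)
    (p : Fin n) : Option (Code (Resp × ℕ)) → Prop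
  | none => (∀ i op, ¬ Pending E i p op) ∧ (p.val = 0 → OwnerQuiet E mem s)
  | some P => ∃ i op, Pending E i p op ∧ (p.val ≠ 0 ↔ op = .steal) ∧ PhaseOK m E mem s i p P op

/-! ### Events of other processes -/

variable {E : List (Event n Loc Val Op Resp)} {e : Event n Loc Val Op Resp} {p : Fin n}

theorem removesNone_snoc {i : ℕ} (h : RemovesNone m E i p)
    (he : e.proc = p → newHead m e ≤ removed m E) : RemovesNone m (E ++ [e]) i p := by
  intro t e' hit ht hp
  rcases getElem?_snoc_eq_some.1 ht with ht | ⟨rfl, rfl⟩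
  · rw [List.take_append_of_le_length (lt_length_of_getElem? ht).le]
    exact h t e' hit ht hp
  · simpa using he hp

theorem removesOnly_snoc {i k : ℕ} (h : RemovesOnly m E i p k)
    (he : e.proc = p → removed m E < newHead m e → removed m E = k) :
    RemovesOnly m (E ++ [e]) i p k := by
  intro t e' hit ht hp
  rcases getElem?_snoc_eq_some.1 ht with ht | ⟨rfl, rfl⟩
  · rw [List.take_append_of_le_length (lt_length_of_getElem? ht).le]
    exact h t e' hit ht hp
  · simpa using he hp

theorem Pending.take_snoc {i : ℕ} {op : Op} (h : Pending E i p op) :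
    (E ++ [e]).take i = E.take i :=
  List.take_append_of_le_length (lt_length_of_getElem? h.1).le

theorem Pending.snoc {i : ℕ} {op : Op} (h : Pending E i p op) (he : ∀ r, e ≠ .res p r) :
    Pending (E ++ [e]) i p op :=
  pending_snoc.2 (Or.inl ⟨h, he⟩)

theorem removed_le_snoc : removed m E ≤ removed m (E ++ [e]) :=
  removed_snoc m E e ▸ le_max_left _ _

theorem inserted_prefix_snoc : inserted E <+: inserted (E ++ [e]) :=
  inserted_snoc E e ▸ List.prefix_append _ _

theorem getElem?_snoc_left {t : ℕ} {e'} (h : E[t]? = some e') : (E ++ [e])[t]? = some e' :=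
  getElem?_snoc_eq_some.2 (Or.inl h)

theorem take_snoc_of_getElem? {t : ℕ} {e'} (h : E[t]? = some e') :
    (E ++ [e]).take t = E.take t :=
  List.take_append_of_le_length (lt_length_of_getElem? h).le

/-- Other processes can only raise `removed` and extend `inserted`; the remaining clauses speak of
the past or of the events of `p`. -/
theorem DequeuePhase.snoc {s i : ℕ} {op : Op} {P : Code (Resp × ℕ)}
    (h : DequeuePhase m E s i p op P) (hi : (E ++ [e]).take i = E.take i) (he : e.proc ≠ p) :
    DequeuePhase m (E ++ [e]) s i p op P := by
  cases h with
  | searching a d code ha hd hnone =>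
    exact .searching a d code (ha.trans removed_le_snoc) (by rwa [hi])
      (removesNone_snoc hnone fun h => absurd h he)
  | claimed k b g code hk hkb hb hlt hg honly =>
    refine .claimed k b g code (by rwa [hi]) hkb (hb.trans removed_le_snoc)
      (hlt.trans_le inserted_prefix_snoc.length_le) (fun x hx => ?_)
      (removesOnly_snoc honly fun h => absurd h he)
    have := hg x hx
    rw [List.getElem?_eq_getElem hlt] at this
    rw [← this]
    exact getElem?_of_prefix inserted_prefix_snoc (List.getElem?_eq_getElem hlt)
  | sawBot hop code hnone hread =>
    obtain ⟨t, l, h1, h2, h3⟩ := hread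
    refine .sawBot hop code (removesNone_snoc hnone fun h => absurd h he)
      ⟨t, l, h1, getElem?_snoc_left h2, ?_⟩
    rwa [take_snoc_of_getElem? h2]

theorem OwnerQuiet.snoc {mem mem' : (l : Loc) → Val l} {s : ℕ} (h : OwnerQuiet E mem s)
    (hput : putVal e = none) (hmem : ∀ j, taskOf mem' j = taskOf mem j) :
    OwnerQuiet (E ++ [e]) mem' s := by
  have : inserted (E ++ [e]) = inserted E := by simp [inserted_snoc, hput]
  exact ⟨this ▸ h.tail_eq, (hmem _).trans h.bot, this ▸ h.le_puts.trans (numPuts_le_snoc E e)⟩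

/-- Only the owner's state depends on the contents of `Tasks` and on the exact number of insertions,
and `hown` says that other processes leave these alone. -/
theorem ProcOK.snoc_of_ne {mem mem' : (l : Loc) → Val l} {s : ℕ} {run : Option (Code (Resp × ℕ))}
    (h : ProcOK m E mem s p run) (he : e.proc ≠ p)
    (hown : p.val = 0 → putVal e = none ∧ ∀ j, taskOf mem' j = taskOf mem j) :
    ProcOK m (E ++ [e]) mem' s p run := by
  have hres : ∀ r, e ≠ .res p r := by
    rintro r rfl
    exact he rfl
  cases run with
  | none =>
    refine ⟨fun i op hp => ?_, fun h0 => (h.2 h0).snoc (hown h0).1 (hown h0).2⟩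
    rcases pending_snoc.1 hp with ⟨hp, -⟩ | ⟨-, rfl⟩
    · exact h.1 i op hp
    · exact he rfl
  | some P =>
    obtain ⟨i, op, hp, hperm, hph⟩ := h
    refine ⟨i, op, hp.snoc hres, hperm, ?_⟩
    have hi : (E ++ [e]).take i = E.take i := hp.take_snoc
    have h0 : op ≠ .steal → p.val = 0 := fun h => by
      by_contra h'
      exact h (hperm.1 h')
    cases op with
    | put x =>
      obtain ⟨b, b', hph⟩ := hph
      obtain ⟨hput, hmem⟩ := hown (h0 (by simp))
      have hins : inserted (E ++ [e]) = inserted E := by simp [inserted_snoc, hput]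
      refine ⟨b, b', hph.code, hi ▸ hph.start, hins ▸ hph.length_eq,
        hph.le_puts.trans (numPuts_le_snoc E e), fun hb => (hmem _).trans (hph.bot hb),
        fun hb => (hmem _).trans (hph.bot' hb), fun hb => ?_⟩
      obtain ⟨t, e', h1, h2, h3⟩ := hph.written hb
      exact ⟨t, e', h1, getElem?_snoc_left h2, h3⟩
    | take =>
      obtain ⟨hput, hmem⟩ := hown (h0 (by simp))
      exact ⟨hph.1.snoc hput hmem, hph.2.snoc hi he⟩
    | steal => exact DequeuePhase.snoc hph hi he

/-! ### The shared memory -/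

theorem MemoryOK.snoc {mem : (l : Loc) → Val l} (h : MemoryOK m E mem) (hput : putVal e = none)
    (hnew : newHead m e ≤ removed m E) : MemoryOK m (E ++ [e]) mem := by
  have h1 : inserted (E ++ [e]) = inserted E := by simp [inserted_snoc, hput]
  have h2 : removed m (E ++ [e]) = removed m E := by rw [removed_snoc, max_eq_left hnew]
  constructor
  · rw [h1, h2]; exact h.removed_le
  · rw [h1]; exact h.task
  · rw [h1]; exact h.bot
  · rw [h2]; exact h.switch

/-- The value grows by at most one, and by `threshold_inj` no other switch stands for the new value,
so the set switches remain an initial segment of the thresholds. -/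
theorem MemoryOK.setSwitch {mem : (l : Loc) → Val l} (h : MemoryOK m E mem) {v : List Bool}
    (hv : 2 ≤ (node m v).2) (hle : threshold m v ≤ removed m E + 1)
    (hlt : removed m E < threshold m v → removed m E < (inserted E).length) :
    MemoryOK m (E ++ [.step p (.switch v) (.write (true : Bool))])
      (Function.update mem (.switch v) (true : Bool)) := by
  set e : Event n Loc Val Op Resp := .step p (.switch v) (.write (true : Bool))
  have h1 : inserted (E ++ [e]) = inserted E :=
    (inserted_snoc E e).trans (List.append_nil _)
  have h2 : removed m (E ++ [e]) = max (removed m E) (threshold m v) := removed_snoc m E e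
  have h3 := h.removed_le
  constructor
  · rw [h1, h2]
    by_cases hc : removed m E < threshold m v
    · have := hlt hc
      omega
    · omega
  · intro k x hx
    rw [taskOf_update_switch]
    exact h.task k x (h1 ▸ hx)
  · rw [taskOf_update_switch, h1]
    exact h.bot
  · intro v' hv'
    rw [switchOf_update_switch, h2]
    split_ifs with hvv
    · subst hvv
      simp
    · rw [h.switch v' hv', le_max_iff]
      refine ⟨Or.inl, fun hor => hor.elim id fun hle' => ?_⟩
      have : threshold m v' ≠ threshold m v := fun heq => hvv (threshold_inj hv' hv heq)
      omega

/-- The new task uses up the `⊥` behind the last task; `hbot` supplies the next one. -/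
theorem MemoryOK.writeTask {mem : (l : Loc) → Val l} (h : MemoryOK m E mem) {x : ℕ+}
    (hbot : taskOf mem ((inserted E).length + 2) = none) :
    MemoryOK m (E ++ [.step p (.task ((inserted E).length + 1)) (.write (some x : Option ℕ+))])
      (Function.update mem (.task ((inserted E).length + 1)) (some x : Option ℕ+)) := by
  set e : Event n Loc Val Op Resp :=
    .step p (.task ((inserted E).length + 1)) (.write (some x : Option ℕ+))
  have h1 : inserted (E ++ [e]) = inserted E ++ [x] := inserted_snoc E e
  have h2 : removed m (E ++ [e]) = removed m E := by
    rw [removed_snoc]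
    exact max_eq_left (Nat.zero_le _)
  constructor
  · rw [h1, h2, List.length_append]
    exact h.removed_le.trans (Nat.le_add_right _ _)
  · intro k y hy
    rw [h1] at hy
    rw [taskOf_update_task]
    rcases getElem?_snoc_eq_some.1 hy with hy | ⟨rfl, rfl⟩
    · have := lt_length_of_getElem? hy
      rw [if_neg (by omega)]
      exact h.task k y hy
    · rw [if_pos rfl]
  · rw [h1, taskOf_update_task, List.length_append, List.length_singleton, if_neg (by omega)]
    exact hbot
  · intro v hv
    rw [switchOf_update_task, h2]
    exact h.switch v hv

theorem MemoryOK.writeBot {mem : (l : Loc) → Val l} (h : MemoryOK m E mem) {j : ℕ}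
    (hj : (inserted E).length < j) :
    MemoryOK m (E ++ [.step p (.task j) (.write (none : Option ℕ+))])
      (Function.update mem (.task j) (none : Option ℕ+)) := by
  set e : Event n Loc Val Op Resp := .step p (.task j) (.write (none : Option ℕ+))
  have h1 : inserted (E ++ [e]) = inserted E :=
    (inserted_snoc E e).trans (List.append_nil _)
  have h2 : removed m (E ++ [e]) = removed m E := by
    rw [removed_snoc]
    exact max_eq_left (Nat.zero_le _)
  constructor
  · rw [h1, h2]
    exact h.removed_le
  · intro k y hy
    rw [h1] at hy
    have := lt_length_of_getElem? hy
    rw [taskOf_update_task, if_neg (by omega)]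
    exact h.task k y hy
  · rw [h1, taskOf_update_task]
    split_ifs
    · rfl
    · exact h.bot
  · intro v hv
    rw [switchOf_update_task, h2]
    exact h.switch v hv

end Invariant

/-! ### Preservation of the invariant by the events of the process itself. -/

section Invariant

variable {n m : ℕ} {E : List (Event n Loc Val Op Resp)} {p : Fin n}

/-! ### Steps of `Take` and `Steal` -/

/-- The consequences of a step of a pending `Take` or `Steal`. -/
structure DequeueStepOK (m : ℕ) (E : List (Event n Loc Val Op Resp)) (mem : (l : Loc) → Val l)
    (s i : ℕ) (p : Fin n) (op : Op) (l : Loc) (a : Instr (Val l))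
    (K : a.Answer → Code (Resp × ℕ)) : Prop where
  event : EventOK m E (.step p l a)
  memory : MemoryOK m (E ++ [.step p l a]) (Function.update mem l (a.next (mem l)))
  noPut : putVal (.step p l a : Event n Loc Val Op Resp) = none
  tasks : ∀ j, taskOf (Function.update mem l (a.next (mem l))) j = taskOf mem j
  phase : DequeuePhase m (E ++ [.step p l a]) s i p op (K (a.answer (mem l)))

theorem putVal_read (p : Fin n) (l : Loc) :
    putVal (.step p l .read : Event n Loc Val Op Resp) = none := by
  cases l <;> rfl

theorem newHead_read (m : ℕ) (p : Fin n) (l : Loc) :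
    newHead m (.step p l .read : Event n Loc Val Op Resp) = 0 := by
  cases l <;> rfl

theorem inserted_snoc_read (l : Loc) : inserted (E ++ [.step p l .read]) = inserted E := by
  rw [inserted_snoc, putVal_read, Option.toList_none, List.append_nil]

theorem removed_snoc_read (l : Loc) : removed m (E ++ [.step p l .read]) = removed m E := by
  rw [removed_snoc, newHead_read, max_eq_left (Nat.zero_le _)]

theorem dequeueStepOK_read {mem : (l : Loc) → Val l} (hm : MemoryOK m E mem) {s i : ℕ} {op : Op}
    {l : Loc} {K : Val l → Code (Resp × ℕ)}
    (h : DequeuePhase m (E ++ [.step p l .read]) s i p op (K (mem l))) :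
    DequeueStepOK m E mem s i p op l .read K := by
  have hmem : Function.update mem l ((Instr.read : Instr (Val l)).next (mem l)) = mem :=
    Function.update_eq_self l mem
  refine ⟨⟨trivial, fun x hx => ?_, fun hlt => ?_⟩, ?_, putVal_read p l, fun j => by rw [hmem], h⟩
  · rw [putVal_read] at hx
    cases hx
  · rw [newHead_read] at hlt
    omega
  · rw [hmem]
    exact hm.snoc (putVal_read p l) (newHead_read m p l ▸ Nat.zero_le _)

/-- The register is at least `k`, and the switches to be set have thresholds at most `k + 1`. So a
write either changes nothing or moves the register from `k` to `k + 1`. -/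
theorem Claimed.dequeueStepOK {mem : (l : Loc) → Val l} (hm : MemoryOK m E mem)
    {s i k b : ℕ} {g : Option (Option ℕ+)} {op : Op} {l : Loc} {a : Instr (Val l)}
    {K : a.Answer → Code (Resp × ℕ)} (hp : Pending E i p op) (hop : op = .take ∨ op = .steal)
    (code : Claimed m k s b g (.step l a K)) (hk : removed m (E.take i) ≤ k) (hkb : k ≤ b)
    (hb : b ≤ removed m E) (hlt : k < (inserted E).length)
    (hg : ∀ x, g = some x → (inserted E)[k]? = x) (honly : RemovesOnly m E i p k) :
    DequeueStepOK m E mem s i p op l a K := by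
  have hread : ∀ {l : Loc} {P : Code (Resp × ℕ)} {b' : ℕ} {g' : Option (Option ℕ+)},
      Claimed m k s b' g' P → k ≤ b' → b' ≤ removed m E →
      (∀ x, g' = some x → (inserted E)[k]? = x) →
      DequeuePhase m (E ++ [.step p l .read]) s i p op P := by
    intro l P b' g' code' hkb' hb' hg'
    refine .claimed k b' g' code' (by rwa [hp.take_snoc]) hkb' (by rwa [removed_snoc_read])
      (by rwa [inserted_snoc_read]) (by rwa [inserted_snoc_read])
      (removesOnly_snoc honly fun _ h => ?_)
    rw [newHead_read] at h
    omega
  cases code with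
  | readSwitch v _ _ F hv hf ht =>
    refine dequeueStepOK_read (l := .switch v) (K := F) hm ?_
    change DequeuePhase _ _ _ _ _ _ (F (switchOf mem v))
    have hsw := hm.switch v hv
    cases hs : switchOf mem v
    · exact hread hf hkb hb hg
    · exact hread ht (le_max_of_le_left hkb) (max_le hb (hsw.1 hs)) hg
  | setSwitch v _ _ F hv hX h =>
    set e : Event n Loc Val Op Resp := .step p (.switch v) (.write (true : Bool))
    have h1 : inserted (E ++ [e]) = inserted E :=
      (inserted_snoc E e).trans (List.append_nil _)
    have h2 : removed m (E ++ [e]) = max (removed m E) (threshold m v) := removed_snoc m E e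
    refine ⟨⟨trivial, fun x hx => ?_, fun hlt' => ?_⟩, hm.setSwitch hv (by omega) fun _ => ?_, rfl,
      fun j => taskOf_update_switch mem v j true, ?_⟩
    · cases hx
    · have hlt' : removed m E < threshold m v := hlt'
      -- Here `k ≤ b ≤ removed m E < threshold m v ≤ k + 1`.
      have hkr : k = removed m E := by omega
      refine ⟨(show threshold m v = _ by omega), by omega, i, op, hp, hop, hkr ▸ honly⟩
    · omega
    · refine .claimed k _ g h (by rwa [hp.take_snoc]) (le_max_of_le_left hkb)
        (h2 ▸ max_le_max_right _ hb) (by rwa [h1]) (by rwa [h1])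
        (removesOnly_snoc honly fun _ hlt' => ?_)
      have hlt' : removed m E < threshold m v := hlt'
      omega
  | readTask _ F h =>
    refine dequeueStepOK_read (l := .task (k + 1)) (K := F) hm ?_
    refine hread (h _) hkb hb fun x hx => ?_
    obtain ⟨y, hy⟩ : ∃ y, (inserted E)[k]? = some y := ⟨_, List.getElem?_eq_getElem hlt⟩
    rw [hy, ← Option.some.inj hx]
    exact (hm.task k y hy).symm

theorem RemovesNone.only {i k : ℕ} (h : RemovesNone m E i p) : RemovesOnly m E i p k :=
  fun t e hit ht hp hlt => absurd (h t e hit ht hp) (not_le.2 hlt)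

/-- While searching, the bracket is justified by the present memory; once it has one value `a`, the
operation claims task `a` if that task has been inserted. -/
theorem DequeuePhase.stepOK {mem : (l : Loc) → Val l} (hm : MemoryOK m E mem)
    (hlen : (inserted E).length ≤ m) {s i : ℕ} {op : Op} {l : Loc} {a : Instr (Val l)}
    {K : a.Answer → Code (Resp × ℕ)} (hp : Pending E i p op) (hop : op = .take ∨ op = .steal)
    (hs : op = .take → s = (inserted E).length)
    (h : DequeuePhase m E s i p op (.step l a K)) : DequeueStepOK m E mem s i p op l a K := by
  have hrl := hm.removed_le
  cases h with
  | claimed k b g code hk hkb hb hlt hg honly =>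
    exact code.dequeueStepOK hm hp hop hk hkb hb hlt hg honly
  | sawBot _ code => cases code
  | searching a d code ha hd hnone =>
    have hnone' : ∀ l, RemovesNone m (E ++ [.step p l .read]) i p := fun l =>
      removesNone_snoc hnone fun _ => newHead_read m p l ▸ Nat.zero_le _
    have hmono := removed_take_le m E i
    cases code with
    | readSwitch v _ _ F hv hf ht =>
      refine dequeueStepOK_read (l := .switch v) (K := F) hm ?_
      change DequeuePhase _ _ _ _ _ _ (F (switchOf mem v))
      have hsw := hm.switch v hv
      cases hs : switchOf mem v
      · refine .searching _ _ hf (by rwa [removed_snoc_read]) ?_ (hnone' _)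
        rw [hp.take_snoc]
        rw [hs] at hsw
        -- An unset switch bounds the present value of the register, and by monotonicity also its
        -- value at the invocation.
        have : ¬ threshold m v ≤ removed m E := fun hle => by simpa using hsw.2 hle
        omega
      · refine .searching _ _ ht ?_ (by rwa [hp.take_snoc]) (hnone' _)
        rw [removed_snoc_read]
        exact hsw.1 hs
    | claim _ _ hop' has h =>
      -- For the owner, `tail` counts the inserted tasks, so `head ≤ tail` means that task `a`
      -- exists. As at most `m` tasks are inserted, `a < m` and the register has room for `a + 1`.
      have := hs hop'
      exact (h (by omega)).dequeueStepOK hm hp hop (by omega) le_rfl ha (by omega)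
        (fun x hx => by cases hx) hnone.only
    | stealTask _ F hop' hn hsome =>
      refine dequeueStepOK_read (l := .task (a + 1)) (K := F) hm ?_
      change DequeuePhase _ _ _ _ _ _ (F (taskOf mem (a + 1)))
      rcases lt_or_ge a (inserted E).length with hlt | hge
      · have hy : (inserted E)[a]? = some (inserted E)[a] := List.getElem?_eq_getElem hlt
        rw [hm.task a _ hy]
        refine .claimed a a _ (hsome _ (by omega)) ?_ le_rfl ?_ ?_ ?_ (hnone' _).only
        · rw [hp.take_snoc]
          omega
        · rwa [removed_snoc_read]
        · rwa [inserted_snoc_read]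
        · rw [inserted_snoc_read]
          intro x hx
          rw [hy, Option.some.inj hx]
      -- The lower bound `a` is at most `removed`, which is at most the number of inserted tasks; so
      -- the entry read is the one that is known to be `⊥`.
      · obtain rfl : a = (inserted E).length := by omega
        rw [hm.bot, hn]
        refine .sawBot hop' rfl (hnone' _) ⟨E.length, _, lt_length_of_getElem? hp.1,
          getElem?_snoc_eq_some.2 (Or.inr ⟨rfl, rfl⟩), ?_⟩
        rw [List.take_left']
        · omega
        · rfl

/-! ### Responses of `Take` and `Steal` -/

theorem Claimed.mayReturn {s i k b : ℕ} {g : Option (Option ℕ+)} {r : Resp} {s' : ℕ}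
    (code : Claimed m k s b g (.ret (r, s'))) (hk : removed m (E.take i) ≤ k)
    (hb : b ≤ removed m E) (hlt : k < (inserted E).length)
    (hg : ∀ x, g = some x → (inserted E)[k]? = x) (honly : RemovesOnly m E i p k) :
    s' = s ∧ ∃ x, r = .val (some x) ∧ MayReturn m E i p x := by
  cases code with
  | done _ x h =>
    have := hg x rfl
    rw [List.getElem?_eq_getElem hlt] at this
    subst this
    exact ⟨rfl, _, rfl, k, hk, by omega, List.getElem?_eq_getElem hlt, honly⟩

/-- For an empty `Take`, `tail < a + 1` and `a ≤ removed m E` leave only the case that all inserted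
tasks are removed. -/
theorem DequeuePhase.responseOK {mem : (l : Loc) → Val l} (hm : MemoryOK m E mem)
    (hlen : (inserted E).length ≤ m) {s i : ℕ} {op : Op} {r : Resp} {s' : ℕ}
    (hop : op = .take ∨ op = .steal) (hs : op = .take → s = (inserted E).length)
    (h : DequeuePhase m E s i p op (.ret (r, s'))) : s' = s ∧ ResponseOK m E i p r op := by
  have hrl := hm.removed_le
  have hval : (s' = s ∧ ∃ x, r = .val (some x) ∧ MayReturn m E i p x) →
      s' = s ∧ ResponseOK m E i p r op := by
    rintro ⟨hss, hx⟩
    rcases hop with rfl | rfl <;> exact ⟨hss, Or.inr hx⟩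
  cases h with
  | claimed k b g code hk hkb hb hlt hg honly => exact hval (code.mayReturn hk hb hlt hg honly)
  | sawBot hop' code hnone hread =>
    cases code
    subst hop'
    exact ⟨rfl, Or.inl ⟨rfl, hnone, hread⟩⟩
  | searching a d code ha hd hnone =>
    have hmono := removed_take_le m E i
    cases code with
    | claim _ _ hop' has h =>
      have := hs hop'
      exact hval ((h (by omega)).mayReturn (by omega) ha (by omega)
        (fun x hx => by cases hx) hnone.only)
    | takeEmpty _ hop' has =>
      have := hs hop'
      subst hop'
      exact ⟨rfl, Or.inl ⟨rfl, by omega, hnone⟩⟩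

/-! ### Preservation of the invariant -/

/-- The consequences of an event of `p` that changes the memory to `mem`, its persistent variable
to `s` and the rest of its program to `run`. -/
structure MoveOK (m : ℕ) (E : List (Event n Loc Val Op Resp)) (mem mem' : (l : Loc) → Val l)
    (s' : ℕ) (run' : Option (Code (Resp × ℕ))) (e : Event n Loc Val Op Resp) : Prop where
  event : EventOK m E e
  memory : MemoryOK m (E ++ [e]) mem'
  proc : ProcOK m (E ++ [e]) mem' s' e.proc run'
  thief : e.proc.val ≠ 0 → putVal e = none ∧ ∀ j, taskOf mem' j = taskOf mem j

/-- The write of the task needs `⊥` in entry `s + 2`, which the write to entry `s + 3` does not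
touch; so the two writes commute. -/
theorem PutPhase.moveOK {mem : (l : Loc) → Val l} (hm : MemoryOK m E mem) {s i : ℕ} {x : ℕ+}
    {l : Loc} {a : Instr (Val l)} {K : a.Answer → Code (Resp × ℕ)} {b b' : Bool}
    (hp : Pending E i p (.put x)) (hperm : p.val ≠ 0 ↔ Op.put x = .steal)
    (h : PutPhase E mem s i p x (.step l a K) b b') :
    MoveOK m E mem (Function.update mem l (a.next (mem l))) s (some (K (a.answer (mem l))))
      (.step p l a) := by
  have h0 : ¬ p.val ≠ 0 := fun h => by simpa using hperm.1 h
  obtain ⟨code, start, hlen, hputs, hbot, hbot', hwr⟩ := h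
  cases code with
  | writeTask _ F hF =>
    have hs : s = (inserted E).length := by simpa using hlen.symm
    subst hs
    set e : Event n Loc Val Op Resp :=
      .step p (.task ((inserted E).length + 1)) (.write (some x : Option ℕ+))
    have h1 : inserted (E ++ [e]) = inserted E ++ [x] := inserted_snoc E e
    refine ⟨⟨trivial, fun y hy => ?_, fun hlt => absurd hlt (Nat.not_lt_zero _)⟩,
      hm.writeTask (hbot rfl), ⟨i, _, hp.snoc (by simp), hperm, true, b', hF, ?_, ?_, ?_, by simp,
        fun hb => ?_, fun _ => ?_⟩, fun h => absurd h h0⟩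
    · obtain rfl : x = y := Option.some.inj hy
      exact ⟨i, hp, start⟩
    · rw [hp.take_snoc]
      exact start
    · rw [h1]
      simp
    · exact hputs.trans (numPuts_le_snoc E e)
    · exact (taskOf_update_task _ _ _ _).trans ((if_neg (by omega)).trans (hbot' hb))
    · exact ⟨E.length, e, lt_length_of_getElem? hp.1, getElem?_snoc_eq_some.2 (Or.inr ⟨rfl, rfl⟩),
        rfl, fun h => by cases h⟩
  | writeBot _ F hF =>
    set e : Event n Loc Val Op Resp := .step p (.task (s + 1 + 2)) (.write (none : Option ℕ+))
    have h1 : inserted (E ++ [e]) = inserted E :=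
      (inserted_snoc E e).trans (List.append_nil _)
    have hb1 : b.toNat ≤ 1 := Bool.toNat_le b
    refine ⟨⟨trivial, fun y hy => ?_, fun hlt => absurd hlt (Nat.not_lt_zero _)⟩,
      hm.writeBot (by omega), ⟨i, _, hp.snoc (by simp), hperm, b, true, hF, ?_, ?_, ?_,
        fun hb => ?_, fun _ => ?_, fun hb => ?_⟩, fun h => absurd h h0⟩
    · cases hy
    · rw [hp.take_snoc]
      exact start
    · rw [h1]
      exact hlen
    · exact hputs.trans (numPuts_le_snoc E e)
    · exact (taskOf_update_task _ _ _ _).trans ((if_neg (by omega)).trans (hbot hb))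
    · exact (taskOf_update_task _ _ _ _).trans (if_pos rfl)
    · obtain ⟨t, e', h1, h2, h3⟩ := hwr hb
      exact ⟨t, e', h1, getElem?_snoc_left h2, h3⟩

theorem ProcOK.step_moveOK {mem : (l : Loc) → Val l} (hm : MemoryOK m E mem)
    (hlen : (inserted E).length ≤ m) {s : ℕ} {l : Loc} {a : Instr (Val l)}
    {K : a.Answer → Code (Resp × ℕ)} (h : ProcOK m E mem s p (some (.step l a K))) :
    MoveOK m E mem (Function.update mem l (a.next (mem l))) s (some (K (a.answer (mem l))))
      (.step p l a) := by
  obtain ⟨i, op, hp, hperm, hph⟩ := h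
  cases op with
  | put x =>
    obtain ⟨b, b', hph⟩ := hph
    exact hph.moveOK hm hp hperm
  | take =>
    obtain ⟨hq, hph⟩ := hph
    have := hph.stepOK hm hlen hp (Or.inl rfl) fun _ => hq.tail_eq
    exact ⟨this.event, this.memory, ⟨i, _, hp.snoc (by simp), hperm,
      hq.snoc this.noPut this.tasks, this.phase⟩, fun _ => ⟨this.noPut, this.tasks⟩⟩
  | steal =>
    have := DequeuePhase.stepOK hm hlen hp (Or.inr rfl) (by simp) hph
    exact ⟨this.event, this.memory, ⟨i, _, hp.snoc (by simp), hperm, this.phase⟩,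
      fun _ => ⟨this.noPut, this.tasks⟩⟩

theorem ProcOK.res_moveOK {mem : (l : Loc) → Val l} (hm : MemoryOK m E mem)
    (hlen : (inserted E).length ≤ m) {s s' : ℕ} {r : Resp}
    (h : ProcOK m E mem s p (some (.ret (r, s')))) :
    MoveOK m E mem mem s' none (.res p r) := by
  have hmem : MemoryOK m (E ++ [.res p r]) mem := hm.snoc rfl (Nat.zero_le _)
  have hnp : ∀ i op, ¬ Pending (E ++ [.res p r]) i p op := by
    intro i op hp
    rcases pending_snoc.1 hp with ⟨-, h⟩ | ⟨-, h⟩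
    · exact h r rfl
    · cases h
  obtain ⟨i, op, hp, hperm, hph⟩ := h
  cases op with
  | put x =>
    obtain ⟨b, b', code, start, hl, hputs, hbot, hbot', hwr⟩ := hph
    cases code with
    | done =>
      have hl : (inserted E).length = s + 1 := hl
      refine ⟨⟨i, _, hp, rfl, hwr rfl⟩, hmem, ⟨hnp, fun _ => ?_⟩, fun _ => ⟨rfl, fun _ => rfl⟩⟩
      -- The `⊥` that this `Put` wrote into entry `s + 3` is the reserve entry for the new value of
      -- `tail`.
      have : OwnerQuiet E mem (s + 1) := ⟨hl.symm, hbot' rfl, by omega⟩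
      exact this.snoc rfl fun _ => rfl
  | take =>
    obtain ⟨hq, hph⟩ := hph
    obtain ⟨rfl, hr⟩ := hph.responseOK hm hlen (Or.inl rfl) fun _ => hq.tail_eq
    exact ⟨⟨i, _, hp, hr⟩, hmem, ⟨hnp, fun _ => hq.snoc rfl fun _ => rfl⟩,
      fun _ => ⟨rfl, fun _ => rfl⟩⟩
  | steal =>
    obtain ⟨rfl, hr⟩ := DequeuePhase.responseOK hm hlen (Or.inr rfl) (by simp) hph
    exact ⟨⟨i, _, hp, hr⟩, hmem, ⟨hnp, fun h0 => absurd rfl (fun _ : p = p => hperm.2 rfl h0)⟩,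
      fun _ => ⟨rfl, fun _ => rfl⟩⟩

theorem ProcOK.inv_moveOK {mem : (l : Loc) → Val l} (hm : MemoryOK m E mem)
    (hlen : (inserted E).length ≤ m) {s : ℕ} {o : LineOrder} {tasks : ℕ → Option ℕ+} {op : Op}
    {P : Code (Resp × ℕ)} (hperm : (wsMult n m o tasks).permits p op)
    (hP : P ∈ (wsMult n m o tasks).code op s) (h : ProcOK m E mem s p none) :
    MoveOK m E mem mem s (some P) (.inv p op) := by
  obtain ⟨hidle, hq⟩ := h
  have hmem : MemoryOK m (E ++ [.inv p op]) mem := hm.snoc rfl (Nat.zero_le _)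
  have hp : Pending (E ++ [.inv p op]) E.length p op := pending_snoc.2 (Or.inr ⟨rfl, rfl⟩)
  have htake : List.take E.length (E ++ [.inv p op]) = E := List.take_left' rfl
  have hins : inserted (E ++ [.inv p op]) = inserted E :=
    (inserted_snoc E (.inv p op)).trans (List.append_nil _)
  have hiff : p.val ≠ 0 ↔ op = .steal := by
    cases op with
    | put x =>
      have h : p.val = 0 := hperm
      simpa using h
    | take =>
      have h : p.val = 0 := hperm
      simpa using h
    | steal =>
      have h : p.val ≠ 0 := hperm
      simpa using h
  refine ⟨⟨hidle, hiff⟩, hmem, ⟨E.length, op, hp, hiff, ?_⟩, fun _ => ⟨rfl, fun _ => rfl⟩⟩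
  have hrem := hm.removed_le
  have hsearch : ∀ {op'}, Searching m op' s 0 (m + 1) P →
      DequeuePhase m (E ++ [.inv p op]) s E.length p op' P := by
    intro op' hc
    -- The initial bracket is the full range of the register: at most `m` tasks are inserted, hence
    -- at most `m` are removed.
    refine .searching 0 (m + 1) hc (Nat.zero_le _) (by rw [htake]; omega) fun t e ht he => ?_
    have := lt_length_of_getElem? he
    simp only [List.length_append, List.length_singleton] at this
    omega
  cases op with
  | put x =>
    have hq := hq hperm
    refine ⟨false, false, putting_of_mem_putCode hP, ?_, ?_, ?_, fun _ => hq.bot, by simp, by simp⟩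
    · rw [htake]
      exact hq.tail_eq.symm
    · rw [hins]
      exact hq.tail_eq.symm
    · have h1 := numPuts_lt_snoc E p x
      have h2 := hq.le_puts
      have h3 := hq.tail_eq
      omega
  | take => exact ⟨(hq hperm).snoc rfl fun _ => rfl, hsearch (searching_of_mem_takeCode hP)⟩
  | steal =>
    obtain rfl : P = stealCode m s := hP
    exact hsearch (searching_stealCode m s)

/-- The invariant of the executions of WS-MULT. -/
structure Invariant (m : ℕ) (E : List (Event n Loc Val Op Resp)) (mem : (l : Loc) → Val l)
    (loc : Fin n → ℕ) (run : Fin n → Option (Code (Resp × ℕ))) : Prop where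
  memory : MemoryOK m E mem
  trace : TraceOK m E
  proc : ∀ p, ProcOK m E mem (loc p) p (run p)

/-- The bound is kept in the state of process 0, the only one that inserts; `p` serves to show that
this process exists. -/
theorem Invariant.length_le {mem : (l : Loc) → Val l} {loc : Fin n → ℕ}
    {run : Fin n → Option (Code (Resp × ℕ))} (h : Invariant m E mem loc run) (p : Fin n) :
    (inserted E).length ≤ numPuts E := by
  let q : Fin n := ⟨0, p.pos⟩
  have hq := h.proc q
  cases hr : run q with
  | none =>
    rw [hr] at hq
    exact (hq.2 rfl).le_puts
  | some P =>
    rw [hr] at hq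
    obtain ⟨i, op, -, hperm, hph⟩ := hq
    cases op with
    | put x =>
      obtain ⟨b, b', hph⟩ := hph
      have h1 := hph.length_eq
      have h2 := hph.le_puts
      have := Bool.toNat_le b
      omega
    | take => exact hph.1.le_puts
    | steal => exact absurd rfl (hperm.2 rfl)

theorem Invariant.move {mem mem' : (l : Loc) → Val l} {loc loc' : Fin n → ℕ}
    {run run' : Fin n → Option (Code (Resp × ℕ))} (h : Invariant m E mem loc run)
    {e : Event n Loc Val Op Resp} (hloc : ∀ q, q ≠ e.proc → loc' q = loc q)
    (hrun : ∀ q, q ≠ e.proc → run' q = run q)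
    (hmove : MoveOK m E mem mem' (loc' e.proc) (run' e.proc) e) :
    Invariant m (E ++ [e]) mem' loc' run' := by
  refine ⟨hmove.memory, h.trace.snoc hmove.event, fun q => ?_⟩
  by_cases hq : q = e.proc
  · rw [hq]
    exact hmove.proc
  · rw [hloc q hq, hrun q hq]
    refine (h.proc q).snoc_of_ne (Ne.symm hq) fun h0 => hmove.thief fun h0' => hq ?_
    exact Fin.ext (h0.trans h0'.symm)

/-- The bound on `Put` passes to prefixes, so before each event at most `m` tasks are inserted, and
no operation writes a value beyond the capacity of `Head`. -/
theorem invariant_of_exec {o : LineOrder} {tasks : ℕ → Option ℕ+} (h1 : tasks 1 = none)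
    (h2 : tasks 2 = none) {c : (wsMult n m o tasks).Config} (hE : (wsMult n m o tasks).Exec E c)
    (hputs : numPuts E ≤ m) : Invariant m E c.mem c.loc c.run := by
  induction hE with
  | nil =>
    refine ⟨⟨le_rfl, by simp [inserted], h1, fun v hv => ?_⟩, fun t e ht => by simp at ht,
      fun p => ⟨fun i op hp => by simpa using hp.1, fun _ => ⟨rfl, h2, Nat.zero_le _⟩⟩⟩
    -- Initially no switch is set, and the threshold of a node with at least two values is positive
    -- because its left half is nonempty.
    refine ⟨fun h => (by cases h), fun h => ?_⟩
    have : threshold m v ≤ 0 := h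
    unfold threshold at this
    omega
  | snoc E c e c' hE he ih =>
    have hle := (numPuts_le_snoc E e).trans hputs
    have hI := ih hle
    have hlen := (hI.length_le e.proc).trans hle
    cases he with
    | inv p op P idle perm hP =>
      refine hI.move (fun q _ => rfl) (fun q hq => Function.update_of_ne hq _ _) ?_
      have := hI.proc p
      rw [idle] at this
      change MoveOK m E c.mem c.mem (c.loc p) (Function.update c.run p (some P) p) _
      rw [Function.update_self]
      exact this.inv_moveOK hI.memory hlen perm hP
    | step p l a K h =>
      refine hI.move (fun q _ => rfl) (fun q hq => Function.update_of_ne hq _ _) ?_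
      have := hI.proc p
      rw [h] at this
      change MoveOK m E c.mem _ (c.loc p) (Function.update c.run p _ p) _
      rw [Function.update_self]
      exact this.step_moveOK hI.memory hlen
    | res p r s h =>
      refine hI.move (fun q hq => Function.update_of_ne hq _ _)
        (fun q hq => Function.update_of_ne hq _ _) ?_
      have := hI.proc p
      rw [h] at this
      change MoveOK m E c.mem c.mem (Function.update c.loc p s p) (Function.update c.run p none p) _
      rw [Function.update_self, Function.update_self]
      exact this.res_moveOK hI.memory hlen

theorem TraceOK.fullyReadWrite (h : TraceOK m E) : FullyReadWrite E := by
  intro p l a hmem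
  obtain ⟨t, ht⟩ := List.mem_iff_getElem?.1 hmem
  exact (h t _ ht).1

end Invariant

end WS

theorem mainTheorem3 :
    ∃ C : ℝ, ∀ (n m : ℕ), 2 ≤ n → 1 ≤ m →
      ∀ (o : WS.LineOrder) (tasks : ℕ → Option ℕ+), tasks 1 = none → tasks 2 = none →
        -- set-linearizable and fully Read/Write
        (∀ E c, (WS.wsMult n m o tasks).Exec E c → WS.AtMostPuts m E →
          WS.SetLinearizable (WS.multSpec n) E ∧ WS.FullyReadWrite E) ∧
        -- step complexity
        (WS.wsMult n m o tasks).StepComplexityLE (WS.AtMostPuts m)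
          (fun op => op = WS.Op.take) (C * Real.log (m + 1)) ∧
        (WS.wsMult n m o tasks).StepComplexityLE (WS.AtMostPuts m)
          (fun op => op = WS.Op.steal) (C * Real.log (m + 1)) ∧
        (WS.wsMult n m o tasks).StepComplexityLE (WS.AtMostPuts m)
          (fun op => ∃ x, op = WS.Op.put x) C ∧
        -- no read-after-write patterns
        (∀ E c, (WS.wsMult n m o tasks).Exec E c → WS.AtMostPuts m E →
          (∀ i p, E[i]? = some (.inv p WS.Op.steal) →
            ∀ l l', ¬ WS.ReadAfterWrite E i l l') ∧
          (∀ i p, E[i]? = some (.inv p WS.Op.take) →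
            ∀ l l', WS.ReadAfterWrite E i l l' →
              o = WS.LineOrder.anyOrder ∧ ∃ head, l' = WS.Loc.task head)) := by
  -- The constant comes from `clog_le_mul_log`; it also exceeds the two steps of `Put`.
  refine ⟨10, fun n m _ hm o tasks h1 h2 => ?_⟩
  have hput : ∀ x, ∀ s, ∀ P ∈ (WS.wsMult n m o tasks).code (.put x) s,
      P.Depth 2 ∧ P.RawFree (fun _ => True) ∅ := fun x s P hP =>
    ⟨WS.depth_of_mem_putCode hP, WS.Prog.rawFree_of_ok (fun _ => trivial) P ∅⟩
  have htake : ∀ s, ∀ P ∈ (WS.wsMult n m o tasks).code .take s,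
      P.Depth (2 * Nat.clog 2 (m + 1) + 1) ∧
        P.RawFree (fun l => o = .anyOrder ∧ ∃ head, l = .task head) ∅ := fun s P hP =>
    ⟨WS.depth_of_mem_takeCode hP, WS.rawFree_of_mem_takeCode hP⟩
  have hsteal : ∀ s, ∀ P ∈ (WS.wsMult n m o tasks).code .steal s,
      P.Depth (2 * Nat.clog 2 (m + 1) + 1) ∧ P.RawFree (fun _ => False) ∅ := by
    rintro s P rfl
    exact ⟨WS.depth_stealCode m s, WS.rawFree_stealCode m s⟩
  refine ⟨fun E c hE hK => ?_, ?_, ?_, ?_, fun E c hE _ => ⟨fun i p hi l l' h => ?_,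
    fun i p hi l l' h => ?_⟩⟩
  · have := (WS.invariant_of_exec h1 h2 hE hK).trace
    exact ⟨this.setLinearizable, this.fullyReadWrite⟩
  · exact WS.Algorithm.stepComplexityLE_of_depth fun op h => h ▸ ⟨_, _, WS.clog_le_mul_log hm, htake⟩
  · exact WS.Algorithm.stepComplexityLE_of_depth fun op h => h ▸ ⟨_, _, WS.clog_le_mul_log hm, hsteal⟩
  · refine WS.Algorithm.stepComplexityLE_of_depth ?_
    rintro op ⟨x, rfl⟩
    exact ⟨_, _, by norm_num, hput x⟩
  · exact (WS.Algorithm.static_of_exec _ _ hE hi hsteal).2.1 l l' h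
  · exact (WS.Algorithm.static_of_exec _ _ hE hi htake).2.1 l l' h
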